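/- **Characterisation of encodings of simple algebras.** *Definitions.* Write $a\circ b=\tfrac12(ab+ba)$. A *special JB algebra* in an associative real $*$-algebra $R$ is a real linear subspace $A\subseteq R$ of self-adjoint elements that contains $1$, is closed under $\circ$, and has a complete norm with $\|a\circ b\|\le\|a\|\|b\|$, $\|a^2\|=\|a\|^2$ and $\|a^2\|\le\|a^2+b^2\|$ for all $a,b\in A$. It is *simple* if $A\neq 0$ and its only Jordan ideals are $0$ and $A$. It is a *spin factor* if $A=\mathbb R 1\oplus V$ for a subspace $V$ with $v^2\in\mathbb R 1$ for all $v\in V$. An *encoding* is a map $\gamma:A\to B$ between special JB algebras with $\operatorname{spec}\gamma(a)=\operatorname{spec}a$ and $\gamma(ta_1+(1-t)a_2)=t\gamma(a_1)+(1-t)\gamma(a_2)$ for all $a,a_1,a_2\in A$ and $t\in[0,1]$ (spectra are taken in the ambient associative algebras). *Setting.* Let $A\subseteq M_n(\mathbb C)$ be a simple special JB algebra which generates $M_n(\mathbb C)$ as a complex associative algebra. Let $\mathcal A$ be any real unital $*$-subalgebra with $A\subseteq\mathcal A\subseteq M_n(\mathbb C)$; for example $\mathcal A=M_n(\mathbb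 C)$, or the real associative algebra generated by $A$. Let $\mathcal B=\bigoplus_i\mathcal B_i$ be a finite direct sum with $\mathcal B_i=M_{m_i}(\mathbb C)$, let $B\subseteq\mathcal B$ be a special JB algebra (hence semisimple), and let $\gamma:A\to B$ be an encoding. An *extended encoding* of $\gamma$ is a unital ring homomorphism $\Gamma:\mathcal A\to\mathcal B$ with $\Gamma|_A=\gamma$ and $\Gamma(\alpha^*)=\Gamma(\alpha)^*$ for all $\alpha\in\mathcal A$. *Statement.* 1. (Existence.) Unless $A$ is a spin factor of real dimension $4k+2$ for some integer $k\ge1$, an extended encoding $\Gamma:\mathcal A\to\mathcal B$ of $\gamma$ exists. 2. (Uniqueness.) If $\mathcal A$ is the real associative algebra generated by $A$ (for instance if $A=\mathrm{Herm}_n(\mathbb C)$ with $n\ge2$ and $\mathcal A=M_n(\mathbb C)$), then at most one unital ring homomorphism $\mathcal A\to\mathcal B$ extends $\gamma$, and any such homomorphism automatically preserves $*$. 3. (Form.) For every extended encoding $\Gamma$ there are $p_i,q_i\in\mathbb N_0$ with $n(p_i+q_i)=m_i$, i.e. $p_i+q_i=m_i/n$, and a unitary $U\in\mathcal B$ such that,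 after identifying the coordinates $\mathbb C^n\otimes\mathbb C^{p_i+q_i}$ with those of $\mathbb C^{m_i}$ by a suitable bijection of standard basis vectors, $$\Gamma(\alpha)=U\Big(\bigoplus_i\big(\alpha^{\oplus p_i}\oplus\bar\alpha^{\oplus q_i}\big)\Big)U^*\qquad\text{for all }\alpha\in\mathcal A,$$ where $\bar\alpha$ is the entrywise complex conjugate of $\alpha$. -/

import Mathlib

/-- The Jordan product `a ∘ b = (ab + ba) / 2` of an associative real algebra. -/
noncomputable def jordanMul {R : Type*} [Ring R] [Algebra ℝ R] (a b : R) : R :=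
  (1 / 2 : ℝ) • (a * b + b * a)

/-- A unital special JB algebra of self-adjoint elements of an associative `*`-algebra `R`:
a real subspace of self-adjoint elements, containing `1`, closed under the Jordan product, and
carrying a complete norm with the three JB axioms. -/
structure IsSpecialJB {R : Type*} [Ring R] [StarRing R] [Algebra ℝ R]
    (A : Submodule ℝ R) : Prop where
  one_mem : (1 : R) ∈ A
  isSelfAdjoint : ∀ a ∈ A, IsSelfAdjoint a
  jordan_mem : ∀ a ∈ A, ∀ b ∈ A, jordanMul a b ∈ A
  exists_norm : ∃ N : Seminorm ℝ A,
    (∀ a, N a = 0 → a = 0) ∧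
    (∀ u : ℕ → A, (∀ ε > 0, ∃ K, ∀ j ≥ K, ∀ k ≥ K, N (u j - u k) < ε) →
      ∃ l, ∀ ε > 0, ∃ K, ∀ k ≥ K, N (u k - l) < ε) ∧
    ∀ a b aa bb ab : A,
      (aa : R) = jordanMul (a : R) a → (bb : R) = jordanMul (b : R) b →
      (ab : R) = jordanMul (a : R) b →
        N ab ≤ N a * N b ∧ N aa = N a ^ 2 ∧ N aa ≤ N (aa + bb)

/-- A Jordan algebra `A` is simple: it is nonzero and its only Jordan ideals are `0` and `A`. -/
def IsSimpleJordan {R : Type*} [Ring R] [Algebra ℝ R] (A : Submodule ℝ R) : Prop :=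
  A ≠ ⊥ ∧ ∀ I : Submodule ℝ R, I ≤ A → (∀ a ∈ A, ∀ x ∈ I, jordanMul a x ∈ I) → I = ⊥ ∨ I = A

/-- `A` is a spin factor: `A = ℝ 1 ⊕ V`, where the square of each element of `V` is a scalar. -/
def IsSpinFactor {R : Type*} [Ring R] [Algebra ℝ R] (A : Submodule ℝ R) : Prop :=
  ∃ V : Submodule ℝ R, Disjoint (Submodule.span ℝ {(1 : R)}) V ∧
    Submodule.span ℝ {(1 : R)} ⊔ V = A ∧ ∀ v ∈ V, ∃ c : ℝ, v * v = c • (1 : R)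

/-- An encoding: a spectrum-preserving convex map. Spectra are taken in the ambient associative
algebras. -/
structure IsEncoding {R S : Type*} [Ring R] [Algebra ℝ R] [Algebra ℂ R]
    [Ring S] [Algebra ℝ S] [Algebra ℂ S] {A : Submodule ℝ R} {B : Submodule ℝ S}
    (γ : A → B) : Prop where
  spectrum_eq : ∀ a : A, spectrum ℂ (γ a : S) = spectrum ℂ (a : R)
  convex : ∀ a₁ a₂ : A, ∀ t : ℝ, 0 ≤ t → t ≤ 1 →
    γ (t • a₁ + (1 - t) • a₂) = t • γ a₁ + (1 - t) • γ a₂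

/-- The full matrix algebra `M_n(ℂ)`; its star is the conjugate transpose. -/
abbrev MatAlg (n : ℕ) : Type := Matrix (Fin n) (Fin n) ℂ

/-- The semisimple algebra `⨁ i, M_{m i}(ℂ)`. -/
abbrev SumMatAlg {ι : Type*} (m : ι → ℕ) : Type _ := ∀ i, MatAlg (m i)

/-- `𝒜` is an enveloping real `*`-algebra of `A` in `M_n(ℂ)`: it contains `A`, and `M_n(ℂ)` is
the complex associative algebra generated by `A`. -/
structure IsEnveloping {n : ℕ} (A : Submodule ℝ (MatAlg n))
    (𝒜 : StarSubalgebra ℝ (MatAlg n)) : Prop where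
  mem : ∀ a ∈ A, a ∈ 𝒜
  adjoin_eq_top : Algebra.adjoin ℂ (A : Set (MatAlg n)) = ⊤

/-- The ring homomorphism `Γ : 𝒜 → S` extends `γ : A → B ⊆ S`. -/
def Extends {R S : Type*} [Ring R] [StarRing R] [Algebra ℝ R] [StarModule ℝ R]
    [Ring S] [Algebra ℝ S] {A : Submodule ℝ R} {B : Submodule ℝ S}
    {𝒜 : StarSubalgebra ℝ R} (Γ : 𝒜 →+* S) (γ : A → B) : Prop :=
  ∀ (x : 𝒜) (a : A), (x : R) = a → Γ x = γ a

/-- An extended encoding of `γ`: a unital associative homomorphism of `*`-algebras that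
extends `γ`. -/
structure IsExtendedEncoding {R S : Type*} [Ring R] [StarRing R] [Algebra ℝ R] [StarModule ℝ R]
    [Ring S] [StarRing S] [Algebra ℝ S] {A : Submodule ℝ R} {B : Submodule ℝ S}
    {𝒜 : StarSubalgebra ℝ R} (Γ : 𝒜 →+* S) (γ : A → B) : Prop where
  extends_map : Extends Γ γ
  map_star : ∀ x, Γ (star x) = star (Γ x)

/-- The block diagonal matrix `α ⊕ ⋯ ⊕ α ⊕ ᾱ ⊕ ⋯ ⊕ ᾱ`, with `p` copies of `α` and `q` copies of
the entrywise complex conjugate `ᾱ`. -/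
def copies {n : ℕ} (p q : ℕ) (α : MatAlg n) :
    Matrix (Fin n × (Fin p ⊕ Fin q)) (Fin n × (Fin p ⊕ Fin q)) ℂ :=
  Matrix.blockDiagonal
    (Sum.elim (fun _ : Fin p => α) (fun _ : Fin q => α.map (starRingEnd ℂ)))

/-! An encoding is first shown to be a Jordan homomorphism. It is affine and fixes `0`, hence
linear. It sends idempotents to idempotents, because a self-adjoint matrix with spectrum in `{0, 1}`
is idempotent. If a sum of two idempotents is idempotent, then they are orthogonal, so spectral
resolutions go to spectral resolutions and squares are preserved; polarisation gives the Jordan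
product.

For existence, consider the graph `G` of `γ` in `M_n(ℂ) × ⨁ M_{m i}(ℂ)`, a Jordan algebra isomorphic
to `A`. The map extends to the real associative envelope of `A` once the first projection is
injective on the envelope of `G`. If `x` in that envelope has first component `0`, so has the
self-adjoint element `x* x`, and positivity reduces the claim to `x* x = 0`.

If `A` is no spin factor, `G` has a frame of at least three minimal idempotents. Simplicity connects
them and yields matrix units; a third index lets matrix coordinates be multiplied by Jordan
operations alone, so `G` contains every self-adjoint element of its envelope
(`IsMatrixRow.mem_of_mem_adjoin`). Thus `x* x` lies in `G`, where the first component determines the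
element.

If `A` is a spin factor, `G` is spanned by `1` and `d` anticommuting symmetries. For `d ≢ 1 (mod 4)`
a star-invariant tracial functional on the envelope is determined by its value at `1`
(`IsCliffordSystem.trace_eq_zero`), so the total trace is a multiple of the trace of the first
component and vanishes on `x* x`. For `d ≡ 1` the product of all generators is central and
self-adjoint, and the argument breaks down; `d = 1` cannot occur, since the vector part would be
central in `M_n(ℂ)`.

The envelope `R` satisfies `R + iR = M_n(ℂ)`, and simplicity of `M_n(ℂ)` makes this sum direct or
`R` everything; either way a star homomorphism on `R` extends to `M_n(ℂ)`. Its form follows from the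
eigenspaces of the image of `i 1`, with eigenvalues `i` and `-i`, which account for the copies of
`α` and `ᾱ`. -/

set_option linter.unusedSectionVars false

/-! ### Jordan algebras of self-adjoint elements -/

section JordanSubspace

open Polynomial

variable {W : Type*} [Ring W] [StarRing W] [Algebra ℝ W]

/-- A real subspace of self-adjoint elements that contains `1` and is closed under the Jordan
product. -/
structure IsJordanSubspace (A : Submodule ℝ W) : Prop where
  one_mem : (1 : W) ∈ A
  star_eq : ∀ a ∈ A, star a = a
  mul_add_mul_mem : ∀ a ∈ A, ∀ b ∈ A, a * b + b * a ∈ A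

theorem IsSpecialJB.isJordanSubspace {A : Submodule ℝ W} (h : IsSpecialJB A) :
    IsJordanSubspace A where
  one_mem := h.one_mem
  star_eq := h.isSelfAdjoint
  mul_add_mul_mem a ha b hb := by
    have := A.smul_mem 2 (h.jordan_mem a ha b hb)
    rwa [jordanMul, smul_smul, show (2 : ℝ) * (1 / 2) = 1 by norm_num, one_smul] at this

namespace IsJordanSubspace

variable {A : Submodule ℝ W} (hA : IsJordanSubspace A)
include hA

theorem mul_self_mem {a : W} (ha : a ∈ A) : a * a ∈ A := by
  have h := A.smul_mem (1 / 2 : ℝ) (hA.mul_add_mul_mem a ha a ha)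
  rwa [← two_smul ℝ (a * a), smul_smul, show (1 / 2 : ℝ) * 2 = 1 by norm_num, one_smul] at h

theorem mul_mem_of_commute {a b : W} (ha : a ∈ A) (hb : b ∈ A) (h : Commute a b) :
    a * b ∈ A := by
  have h2 := A.smul_mem (1 / 2 : ℝ) (hA.mul_add_mul_mem a ha b hb)
  rwa [← h.eq, ← two_smul ℝ (a * b), smul_smul, show (1 / 2 : ℝ) * 2 = 1 by norm_num,
    one_smul] at h2

/-- The triple product is a Jordan polynomial: with `{x, y} = xy + yx`, twice `abc + cba` is `{{a,
b}, c} + {{b, c}, a} - {{a, c}, b}`. It keeps the symmetrised Peirce components `p a q + q a p` in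
`A`. -/
theorem triple_mem {a b c : W} (ha : a ∈ A) (hb : b ∈ A) (hc : c ∈ A) :
    a * b * c + c * b * a ∈ A := by
  have h1 := hA.mul_add_mul_mem _ (hA.mul_add_mul_mem a ha b hb) c hc
  have h2 := hA.mul_add_mul_mem _ (hA.mul_add_mul_mem b hb c hc) a ha
  have h3 := hA.mul_add_mul_mem _ (hA.mul_add_mul_mem a ha c hc) b hb
  have h := A.smul_mem (1 / 2 : ℝ) (A.sub_mem (A.add_mem h1 h2) h3)
  have e : (a * b + b * a) * c + c * (a * b + b * a) + ((b * c + c * b) * a + a * (b * c + c * b))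
      - ((a * c + c * a) * b + b * (a * c + c * a)) = (2 : ℝ) • (a * b * c + c * b * a) := by
    rw [two_smul]; noncomm_ring
  rwa [e, smul_smul, show (1 / 2 : ℝ) * 2 = 1 by norm_num, one_smul] at h

theorem mul_mul_mem {a b : W} (ha : a ∈ A) (hb : b ∈ A) : a * b * a ∈ A := by
  have h := A.smul_mem (1 / 2 : ℝ) (hA.triple_mem ha hb ha)
  rwa [← two_smul ℝ (a * b * a), smul_smul, show (1 / 2 : ℝ) * 2 = 1 by norm_num, one_smul] at h

theorem pow_mem {a : W} (ha : a ∈ A) (k : ℕ) : a ^ k ∈ A := by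
  induction k with
  | zero => simpa using hA.one_mem
  | succ k ih =>
    rw [pow_succ]; exact hA.mul_mem_of_commute ih ha ((Commute.refl a).pow_left k)

theorem aeval_mem {a : W} (ha : a ∈ A) (p : ℝ[X]) : aeval a p ∈ A := by
  rw [aeval_eq_sum_range]
  exact A.sum_mem fun i _ => A.smul_mem _ (hA.pow_mem ha i)

end IsJordanSubspace

end JordanSubspace

/-! ### Polynomial calculus of self-adjoint matrices -/

section Spectrum

open Polynomial

theorem MatAlg.aeval_eq_of_eqOn_spectrum {n : ℕ} {M : MatAlg n} (hM : star M = M) {p q : ℝ[X]}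
    (h : ∀ x : ℝ, (x : ℂ) ∈ spectrum ℂ M → p.eval x = q.eval x) : aeval M p = aeval M q := by
  have hs : IsSelfAdjoint M := hM
  rw [← cfc_polynomial p M hs, ← cfc_polynomial q M hs]
  refine cfc_congr fun x hx => h x ?_
  exact (spectrum.algebraMap_mem_iff ℂ (r := x)).2 hx

theorem SumMatAlg.aeval_eq_of_eqOn_spectrum {ι : Type*} {m : ι → ℕ} {M : SumMatAlg m}
    (hM : star M = M) {p q : ℝ[X]}
    (h : ∀ x : ℝ, (x : ℂ) ∈ spectrum ℂ M → p.eval x = q.eval x) : aeval M p = aeval M q := by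
  funext i
  have e : ∀ p : ℝ[X], (aeval M p) i = aeval (M i) p := fun p =>
    (aeval_algHom_apply (Pi.evalAlgHom ℝ (fun i => MatAlg (m i)) i) M p).symm
  rw [e, e]
  refine MatAlg.aeval_eq_of_eqOn_spectrum (congrFun hM i) fun x hx => h x ?_
  exact AlgHom.spectrum_apply_subset (Pi.evalAlgHom ℂ (fun i => MatAlg (m i)) i) M hx

theorem SumMatAlg.mul_self_eq_of_spectrum {ι : Type*} {m : ι → ℕ} {M : SumMatAlg m}
    (hM : star M = M) (h : spectrum ℂ M ⊆ {0, 1}) : M * M = M := by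
  have := SumMatAlg.aeval_eq_of_eqOn_spectrum hM (p := X * X) (q := X) fun x hx => by
    rcases h hx with h | h
    · have : x = 0 := by exact_mod_cast h
      simp [this]
    · have : x = 1 := by exact_mod_cast Set.mem_singleton_iff.1 h
      simp [this]
  simpa using this

end Spectrum

/-- Orthogonality of idempotents becomes visible to a merely additive map: it is enough that the sum
is again idempotent. -/
theorem mul_add_mul_eq_zero_of_add_idempotent {R : Type*} [Ring R] {p q : R}
    (hp : p * p = p) (hq : q * q = q) (h : (p + q) * (p + q) = p + q) : p * q + q * p = 0 := by
  have : (p + q) * (p + q) = (p + q) + (p * q + q * p) := by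
    rw [add_mul, mul_add, mul_add, hp, hq]; abel
  rw [this] at h
  simpa using h

/-! ### Encodings are Jordan homomorphisms -/

section Encoding

open Polynomial

variable {n : ℕ} {ι : Type*} {m : ι → ℕ} {A : Submodule ℝ (MatAlg n)}
  {B : Submodule ℝ (SumMatAlg m)} {γ : A → B}

/-- A self-adjoint element with spectrum `{0}` vanishes. For `n = 0` the spectrum of `0` would be
empty, hence `n ≠ 0`. -/
theorem IsEncoding.map_zero (hn : n ≠ 0) (hB : IsJordanSubspace B) (hγ : IsEncoding γ) :
    γ 0 = 0 := by
  have : NeZero n := ⟨hn⟩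
  have hs := hγ.spectrum_eq 0
  rw [ZeroMemClass.coe_zero, spectrum.zero_eq] at hs
  have := SumMatAlg.aeval_eq_of_eqOn_spectrum (hB.star_eq _ (γ 0).2) (p := X) (q := 0)
    fun x hx => by
      rw [hs] at hx
      have : x = 0 := by exact_mod_cast Set.mem_singleton_iff.1 hx
      simp [this]
  ext1
  simpa using this

/-- An encoding, as a linear map. -/
theorem IsEncoding.exists_linearMap (hn : n ≠ 0) (hB : IsJordanSubspace B) (hγ : IsEncoding γ) :
    ∃ g : A →ₗ[ℝ] SumMatAlg m, ∀ a, g a = γ a := by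
  have h0 := hγ.map_zero hn hB
  -- Convexity against `0` gives homogeneity on `[0, 1]`, inversion gives it for `t ≥ 1`, and the
  -- midpoint of `2a` and `2b` gives additivity.
  have h1 : ∀ (t : ℝ) (a : A), 0 ≤ t → t ≤ 1 → γ (t • a) = t • γ a := fun t a ht ht' => by
    simpa [h0] using hγ.convex a 0 t ht ht'
  have h2 : ∀ (t : ℝ) (a : A), 0 ≤ t → γ (t • a) = t • γ a := fun t a ht => by
    rcases le_total t 1 with h | h
    · exact h1 t a ht h
    · have hne : t ≠ 0 := by linarith
      have := h1 t⁻¹ (t • a) (inv_nonneg.2 ht) (inv_le_one_of_one_le₀ h)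
      rw [inv_smul_smul₀ hne] at this
      rw [this, smul_inv_smul₀ hne]
  have hadd : ∀ a b : A, γ (a + b) = γ a + γ b := fun a b => by
    have := hγ.convex ((2 : ℝ) • a) ((2 : ℝ) • b) (1 / 2) (by norm_num) (by norm_num)
    rw [h2 2 a (by norm_num), h2 2 b (by norm_num), smul_smul, smul_smul, smul_smul,
      smul_smul] at this
    norm_num at this
    exact this
  have hneg : ∀ a : A, γ (-a) = -γ a := fun a => by
    have := hadd a (-a)
    rw [add_neg_cancel, h0] at this
    exact (neg_eq_of_add_eq_zero_right this.symm).symm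
  refine ⟨{ toFun := fun a => γ a, map_add' := fun a b => by simp [hadd],
            map_smul' := fun t a => ?_ }, fun a => rfl⟩
  rcases le_total 0 t with h | h
  · simp [h2 t a h]
  · have := h2 (-t) a (by linarith)
    rw [neg_smul t a, hneg, neg_smul t (γ a), neg_inj] at this
    simp [this]

theorem IsEncoding.map_one (hn : n ≠ 0) (hA : IsJordanSubspace A) (hB : IsJordanSubspace B)
    (hγ : IsEncoding γ) : (γ ⟨1, hA.one_mem⟩ : SumMatAlg m) = 1 := by
  have : NeZero n := ⟨hn⟩
  have hs := hγ.spectrum_eq ⟨1, hA.one_mem⟩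
  rw [spectrum.one_eq] at hs
  have := SumMatAlg.aeval_eq_of_eqOn_spectrum (hB.star_eq _ (γ ⟨1, hA.one_mem⟩).2) (p := X)
    (q := 1) fun x hx => by
      rw [hs] at hx
      have : x = 1 := by exact_mod_cast Set.mem_singleton_iff.1 hx
      simp [this]
  simpa using this

theorem IsEncoding.map_idempotent (hB : IsJordanSubspace B) (hγ : IsEncoding γ) (p : A)
    (hp : (p : MatAlg n) * p = p) : (γ p : SumMatAlg m) * γ p = γ p :=
  SumMatAlg.mul_self_eq_of_spectrum (hB.star_eq _ (γ p).2)
    (hγ.spectrum_eq p ▸ IsIdempotentElem.spectrum_subset ℂ hp)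

/-- An encoding preserves squares. -/
theorem IsEncoding.map_mul_self (hA : IsJordanSubspace A)
    (hB : IsJordanSubspace B) (hγ : IsEncoding γ) (g : A →ₗ[ℝ] SumMatAlg m)
    (hg : ∀ a, g a = γ a) (a b : A) (hb : (b : MatAlg n) = a * a) : g b = g a * g a := by
  classical
  have hfin : (spectrum ℝ (a : MatAlg n)).Finite := Matrix.finite_real_spectrum
  set s := hfin.toFinset with hs
  have hmem : ∀ x : ℝ, (x : ℂ) ∈ spectrum ℂ (a : MatAlg n) → x ∈ s := fun x hx => by
    rw [hs, Set.Finite.mem_toFinset]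
    exact (spectrum.algebraMap_mem_iff ℂ (r := x)).1 hx
  have hstar := hA.star_eq a a.2
  -- The spectral projections of `a`, written as Lagrange polynomials in `a` so that they lie in
  -- `A`.
  let e : ℝ → A := fun x => ⟨aeval (a : MatAlg n) (Lagrange.basis s id x), hA.aeval_mem a.2 _⟩
  have hself : ∀ x ∈ s, (Lagrange.basis s id x).eval x = 1 := fun x hx =>
    Lagrange.eval_basis_self (v := id) Function.injective_id.injOn hx
  have hne : ∀ x y, x ≠ y → y ∈ s → (Lagrange.basis s id x).eval y = 0 := fun x y hxy hy =>
    Lagrange.eval_basis_of_ne (v := id) hxy hy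
  have hid : ∀ x ∈ s, (e x : MatAlg n) * e x = e x := fun x hx => by
    simp only [e, ← map_mul]
    refine MatAlg.aeval_eq_of_eqOn_spectrum hstar fun y hy => ?_
    rw [eval_mul]
    by_cases hxy : x = y
    · rw [← hxy, hself x hx, one_mul]
    · rw [hne x y hxy (hmem y hy), zero_mul]
  have horth : ∀ x y, x ≠ y → (e x : MatAlg n) * e y = 0 := fun x y hxy => by
    simp only [e, ← map_mul]
    refine Eq.trans ?_ (_root_.map_zero (aeval (R := ℝ) (a : MatAlg n)))
    refine MatAlg.aeval_eq_of_eqOn_spectrum hstar fun z hz => ?_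
    rw [eval_mul, eval_zero]
    by_cases hxz : x = z
    · rw [hne y z (fun h => hxy (hxz.trans h.symm)) (hmem z hz), mul_zero]
    · rw [hne x z hxz (hmem z hz), zero_mul]
  have hsum : ∀ q : ℝ[X], aeval (a : MatAlg n) q = ∑ x ∈ s, q.eval x • (e x : MatAlg n) := by
    intro q
    simp only [e, ← map_smul, ← map_sum]
    refine MatAlg.aeval_eq_of_eqOn_spectrum hstar fun z hz => ?_
    rw [eval_finsetSum, Finset.sum_eq_single z]
    · rw [eval_smul, hself z (hmem z hz), smul_eq_mul, mul_one]
    · intro y _ hy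
      rw [eval_smul, hne y z hy (hmem z hz), smul_zero]
    · intro h; exact absurd (hmem z hz) h
  have ha' : a = ∑ x ∈ s, x • e x := by
    ext1; simpa using hsum X
  have hb' : b = ∑ x ∈ s, (x * x) • e x := by
    have := hsum (X * X)
    rw [_root_.map_mul, aeval_X] at this
    ext1; rw [hb, this]; simp
  have gid : ∀ x ∈ s, g (e x) * g (e x) = g (e x) := fun x hx => by
    rw [hg]; exact hγ.map_idempotent hB _ (hid x hx)
  have gorth : ∀ x ∈ s, ∀ y ∈ s, x ≠ y → g (e x) * g (e y) + g (e y) * g (e x) = 0 :=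
    fun x hx y hy hxy => by
      refine mul_add_mul_eq_zero_of_add_idempotent (gid x hx) (gid y hy) ?_
      rw [← map_add, hg]
      refine hγ.map_idempotent hB _ ?_
      rw [Submodule.coe_add, add_mul, mul_add, mul_add, hid x hx, hid y hy, horth x y hxy,
        horth y x (Ne.symm hxy), add_zero, zero_add]
  -- Anticommuting idempotents are orthogonal: multiplying `pq = -qp` by `p` on the left and on the
  -- right gives `pq = -pqp = qp`, hence `2pq = 0`.
  have gorth' : ∀ x ∈ s, ∀ y ∈ s, x ≠ y → g (e x) * g (e y) = 0 := fun x hx y hy hxy => by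
    have h1 := gorth x hx y hy hxy
    have h2 : g (e x) * g (e y) = -(g (e y) * g (e x)) := eq_neg_of_add_eq_zero_left h1
    have h3 : g (e x) * g (e y) = - (g (e x) * (g (e y) * g (e x))) := by
      calc g (e x) * g (e y) = g (e x) * (g (e x) * g (e y)) := by
            rw [← mul_assoc, gid x hx]
        _ = _ := by rw [h2, mul_neg]
    have h4 : g (e y) * g (e x) = - (g (e x) * (g (e y) * g (e x))) := by
      calc g (e y) * g (e x) = g (e y) * g (e x) * g (e x) := by rw [mul_assoc, gid x hx]
        _ = -(g (e x) * g (e y)) * g (e x) := by rw [h2, neg_neg]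
        _ = _ := by rw [neg_mul, mul_assoc]
    have h5 : g (e x) * g (e y) = g (e y) * g (e x) := h3.trans h4.symm
    rw [← h5, ← two_smul ℝ] at h1
    exact (smul_eq_zero.1 h1).resolve_left two_ne_zero
  rw [hb', ha', map_sum, map_sum, Finset.sum_mul_sum]
  refine Finset.sum_congr rfl fun x hx => ?_
  rw [Finset.sum_eq_single x]
  · rw [map_smul, map_smul, smul_mul_smul_comm, gid x hx]
  · intro y hy hxy
    rw [map_smul, map_smul, smul_mul_smul_comm, gorth' x hx y hy (Ne.symm hxy), smul_zero]
  · intro h; exact absurd hx h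

/-- An encoding is a Jordan homomorphism. -/
theorem IsEncoding.map_mul_add_mul (hA : IsJordanSubspace A)
    (hB : IsJordanSubspace B) (hγ : IsEncoding γ) (g : A →ₗ[ℝ] SumMatAlg m)
    (hg : ∀ a, g a = γ a) (a b c : A) (hc : (c : MatAlg n) = a * b + b * a) :
    g c = g a * g b + g b * g a := by
  have h := fun a => hγ.map_mul_self hA hB g hg a ⟨_, hA.mul_self_mem a.2⟩ rfl
  have h1 := h (a + b)
  rw [map_add] at h1
  have e : (⟨_, hA.mul_self_mem (a + b).2⟩ : A) =
      ⟨_, hA.mul_self_mem a.2⟩ + ⟨_, hA.mul_self_mem b.2⟩ + c := by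
    ext1
    simp only [Submodule.coe_add, hc]
    noncomm_ring
  rw [e, map_add, map_add, h a, h b] at h1
  have h2 : (g a + g b) * (g a + g b) = g a * g a + g b * g b + (g a * g b + g b * g a) := by
    noncomm_ring
  rw [h2] at h1
  exact add_left_cancel h1

end Encoding

/-! ### Spectral idempotents and frames of minimal idempotents -/

section Frames

open Polynomial

variable {W : Type*} [Ring W] [StarRing W] [Algebra ℝ W]

/-- `hW` is the positivity of the involution. Stating it abstractly allows the structure theory to
be applied to the product algebra that holds the graph of `γ`. -/
theorem eq_zero_of_star_mul_self_eq_zero (hW : ∀ x y : W, star x * x + star y * y = 0 → x = 0)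
    {x : W} (h : star x * x = 0) : x = 0 :=
  hW x 0 (by simp [h])

theorem star_aeval [StarModule ℝ W] {b : W} (hb : star b = b) (p : ℝ[X]) :
    star (aeval b p) = aeval b p := by
  simp [aeval_eq_sum_range, star_sum, star_smul, hb]

theorem aeval_ne_zero_of_minpoly_eq_mul {b : W} (hint : IsIntegral ℝ b) {p q : ℝ[X]}
    (h : minpoly ℝ b = p * q) (hp : p.natDegree ≠ 0) : aeval b q ≠ 0 := by
  intro h0
  have hm := minpoly.ne_zero hint
  have hq : q ≠ 0 := fun hq => hm (by rw [h, hq, mul_zero])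
  have hp0 : p ≠ 0 := fun hp => hm (by rw [h, hp, zero_mul])
  have h1 := natDegree_le_of_dvd (minpoly.dvd ℝ b h0) hq
  rw [h, natDegree_mul hp0 hq] at h1
  omega

/-- The self-adjoint element `(pq)(b)` has square zero. Consequently the minimal polynomial of a
self-adjoint element has no repeated factor. -/
theorem aeval_mul_eq_zero_of_mul_mul [StarModule ℝ W]
    (hW : ∀ x y : W, star x * x + star y * y = 0 → x = 0) {b : W} (hb : star b = b) {p q : ℝ[X]}
    (h : aeval b (p * p * q) = 0) : aeval b (p * q) = 0 := by
  apply eq_zero_of_star_mul_self_eq_zero hW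
  rw [star_aeval hb, ← map_mul, show p * q * (p * q) = p * p * q * q by ring, map_mul, h, zero_mul]

/-- A nonzero self-adjoint element has a spectral idempotent for a nonzero eigenvalue. -/
theorem exists_aeval_idempotent [StarModule ℝ W]
    (hW : ∀ x y : W, star x * x + star y * y = 0 → x = 0) {b : W} (hb : star b = b)
    (hint : IsIntegral ℝ b) (hb0 : b ≠ 0) :
    ∃ (g : ℝ[X]) (r : ℝ), r ≠ 0 ∧ aeval b g ≠ 0 ∧ aeval b g * aeval b g = aeval b g ∧
      b * aeval b g = r • aeval b g := by
  have hm := minpoly.ne_zero hint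
  have haev : aeval b (minpoly ℝ b) = 0 := minpoly.aeval ℝ b
  have : Nontrivial W := ⟨b, 0, hb0⟩
  have hXC : ∀ r : ℝ, (X - C r : ℝ[X]).natDegree ≠ 0 := fun r => by simp
  have hsq : ∀ (r : ℝ) (g k : ℝ[X]), minpoly ℝ b = (X - C r) * g → g = (X - C r) * k → False := by
    intro r g k h1 h2
    refine aeval_ne_zero_of_minpoly_eq_mul hint h1 (hXC r) ?_
    rw [h2]
    apply aeval_mul_eq_zero_of_mul_mul hW hb
    rw [mul_assoc, ← h2, ← h1, haev]
  -- A factor of the minimal polynomial that has a nonzero root: strip the root `0` if present. It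
  -- is simple by `hsq`, and the quotient is not constant because `b ≠ 0`.
  obtain ⟨h, hdvd, h0, hdeg⟩ : ∃ h : ℝ[X], h ∣ minpoly ℝ b ∧ h.eval 0 ≠ 0 ∧ h.degree ≠ 0 := by
    by_cases h0 : (minpoly ℝ b).eval 0 = 0
    · obtain ⟨g, hg⟩ := dvd_iff_isRoot.2 (show (minpoly ℝ b).IsRoot 0 from h0)
      refine ⟨g, ⟨_, by rw [hg, mul_comm]⟩, fun h1 => ?_, fun h1 => ?_⟩
      · obtain ⟨k, hk⟩ := dvd_iff_isRoot.2 (show g.IsRoot 0 from h1)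
        exact hsq 0 g k hg hk
      · rw [eq_C_of_degree_eq_zero h1] at hg
        have hc : g.coeff 0 ≠ 0 := fun h => hm (by rw [hg, h, map_zero, mul_zero])
        rw [hg] at haev
        rw [map_mul, aeval_C, ← Algebra.commutes, ← Algebra.smul_def] at haev
        have := (smul_eq_zero.1 haev).resolve_left hc
        exact hb0 (by simpa using this)
    · exact ⟨_, dvd_rfl, h0, (minpoly.degree_pos hint).ne'⟩
  obtain ⟨z, hz⟩ := IsAlgClosed.exists_aeval_eq_zero ℂ h hdeg
  have hz0 : z ≠ 0 := by
    rintro rfl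
    apply h0
    have : (0 : ℂ) = algebraMap ℝ ℂ 0 := by simp
    rw [this, aeval_algebraMap_apply] at hz
    simpa using hz
  by_cases him : z.im = 0
  · have hzr : z = algebraMap ℝ ℂ z.re := by
      apply Complex.ext <;> simp [him]
    set r := z.re with hr
    have hr0 : r ≠ 0 := fun h => hz0 (by rw [hzr, h, map_zero])
    have hroot : (minpoly ℝ b).IsRoot r := by
      obtain ⟨k, hk⟩ := hdvd
      rw [hzr, aeval_algebraMap_apply] at hz
      have : h.eval r = 0 := by simpa using hz
      rw [hk]; simp [this]
    obtain ⟨g, hg⟩ := dvd_iff_isRoot.2 hroot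
    have hgb := aeval_ne_zero_of_minpoly_eq_mul hint hg (hXC r)
    have hgr : g.eval r ≠ 0 := fun h1 => by
      obtain ⟨k, hk⟩ := dvd_iff_isRoot.2 (show g.IsRoot r from h1)
      exact hsq r g k hg hk
    have hbg : b * aeval b g = r • aeval b g := by
      rw [hg, map_mul, map_sub, aeval_X, aeval_C, sub_mul, ← Algebra.smul_def, sub_eq_zero] at haev
      exact haev
    -- Modulo `X - r` the cofactor `g` is the constant `g(r)`, so `g² ≡ g(r) g` modulo the minimal
    -- polynomial; dividing by `g(r)` makes `g(b)` idempotent.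
    obtain ⟨k, hk⟩ := X_sub_C_dvd_sub_C_eval (p := g) (a := r)
    have hgg : aeval b g * aeval b g = g.eval r • aeval b g := by
      have : g = (X - C r) * k + C (g.eval r) := by rw [← hk]; ring
      have e : g * g = minpoly ℝ b * k + C (g.eval r) * g := by
        conv_lhs => lhs; rw [this]
        rw [hg]; ring
      rw [← map_mul, e, map_add, map_mul, haev, zero_mul, zero_add, map_mul, aeval_C,
        ← Algebra.smul_def]
    refine ⟨C (g.eval r)⁻¹ * g, r, hr0, ?_, ?_, ?_⟩ <;>
      rw [map_mul, aeval_C, ← Algebra.smul_def]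
    · exact smul_ne_zero (inv_ne_zero hgr) hgb
    · rw [smul_mul_smul_comm, hgg, smul_smul, mul_assoc, inv_mul_cancel₀ hgr, mul_one]
    · rw [mul_smul_comm, hbg, smul_comm]
  · exfalso
    obtain ⟨g, hg⟩ := (quadratic_dvd_of_aeval_eq_zero_im_ne_zero h hz him).trans hdvd
    have hnorm : ‖z‖ ^ 2 = z.re * z.re + z.im * z.im := by
      rw [Complex.sq_norm, Complex.normSq_apply]
    have hQ : (X ^ 2 - C (2 * z.re) * X + C (‖z‖ ^ 2) : ℝ[X]).natDegree ≠ 0 := by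
      have : (X ^ 2 - C (2 * z.re) * X + C (‖z‖ ^ 2) : ℝ[X]).natDegree = 2 := by
        compute_degree!
      omega
    refine aeval_ne_zero_of_minpoly_eq_mul hint hg hQ ?_
    -- A non-real root gives the factor `(X - re z)² + (im z)²`, so the squares of `im z · g(b)` and
    -- `(b - re z) g(b)` add up to zero, against positivity.
    have := hW (z.im • aeval b g) (aeval b ((X - C z.re) * g)) ?_
    · exact (smul_eq_zero.1 this).resolve_left him
    · rw [star_smul, star_aeval hb, star_aeval hb, smul_mul_smul_comm, ← map_mul, ← map_mul,
        star_trivial, ← map_smul, ← map_add]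
      have e : (z.im * z.im) • (g * g) + (X - C z.re) * g * ((X - C z.re) * g)
          = minpoly ℝ b * g := by
        rw [hg, hnorm, smul_eq_C_mul]
        simp only [map_add, map_mul, map_ofNat]
        ring
      rw [e, map_mul, haev, zero_mul]

/-- A minimal idempotent of `A`: a nonzero idempotent `p` with `p A p = ℝ p`. -/
structure IsMinimalIdempotent (A : Submodule ℝ W) (p : W) : Prop where
  mem : p ∈ A
  mul_self : p * p = p
  ne_zero : p ≠ 0
  exists_smul : ∀ a ∈ A, ∃ c : ℝ, p * a * p = c • p

/-- The Peirce corner `e A e` of an idempotent `e`. -/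
def peirceCorner (A : Submodule ℝ W) (e : W) : Submodule ℝ W where
  carrier := {a | a ∈ A ∧ e * a = a ∧ a * e = a}
  add_mem' := fun ha hb => ⟨A.add_mem ha.1 hb.1, by rw [mul_add, ha.2.1, hb.2.1],
    by rw [add_mul, ha.2.2, hb.2.2]⟩
  zero_mem' := ⟨A.zero_mem, by simp, by simp⟩
  smul_mem' := fun c a ha => ⟨A.smul_mem c ha.1, by rw [mul_smul_comm, ha.2.1],
    by rw [smul_mul_assoc, ha.2.2]⟩

variable {A : Submodule ℝ W}

/-- Some `b = e a e` is not a multiple of `e`. A spectral idempotent `q` of `b` for an eigenvalue `r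
≠ 0` satisfies `q = r⁻¹ b q`, which puts it under `e`, and `q = e` would give `b = r e`. -/
theorem IsJordanSubspace.exists_sub_idempotent [StarModule ℝ W] [FiniteDimensional ℝ W]
    (hW : ∀ x y : W, star x * x + star y * y = 0 → x = 0) (hA : IsJordanSubspace A) {e : W}
    (he : e ∈ A) (hee : e * e = e) (he0 : e ≠ 0) (hmin : ¬ IsMinimalIdempotent A e) :
    ∃ q ∈ A, q * q = q ∧ q ≠ 0 ∧ q ≠ e ∧ e * q = q ∧ q * e = q := by
  obtain ⟨a, ha, hc⟩ : ∃ a ∈ A, ∀ c : ℝ, e * a * e ≠ c • e := by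
    by_contra h
    push Not at h
    exact hmin ⟨he, hee, he0, h⟩
  set b := e * a * e with hb
  have hbA : b ∈ A := hA.mul_mul_mem he ha
  have hb0 : b ≠ 0 := fun h => hc 0 (by rw [h, zero_smul])
  have heb : e * b = b := by rw [hb, ← mul_assoc, ← mul_assoc, hee]
  have hbe : b * e = b := by rw [hb, mul_assoc, hee]
  obtain ⟨g, r, hr, hq0, hqq, hbq⟩ := exists_aeval_idempotent hW (hA.star_eq b hbA)
    (Algebra.IsIntegral.isIntegral b) hb0
  set q := aeval b g with hq
  have hcomm : q * b = b * q := by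
    rw [hq]
    have := congrArg (aeval b) (mul_comm g X)
    rwa [map_mul, map_mul, aeval_X] at this
  have hqe : q = r⁻¹ • (b * q) := by rw [hbq, inv_smul_smul₀ hr]
  have h1 : e * q = q := by
    rw [hqe, mul_smul_comm, ← mul_assoc, heb]
  have h2 : q * e = q := by
    rw [hqe, ← hcomm, smul_mul_assoc, mul_assoc, hbe]
  refine ⟨q, hA.aeval_mem hbA g, hqq, hq0, fun h => hc r ?_, h1, h2⟩
  rw [h, hbe] at hbq
  exact hbq

/-- Split a non-minimal `e` as `q + (e - q)` and recurse. The Peirce corner strictly shrinks, and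
subspaces of a finite-dimensional space are well-founded, so the induction runs over the corner `C`.
-/
theorem IsJordanSubspace.exists_frame_of_idempotent [StarModule ℝ W] [FiniteDimensional ℝ W]
    (hW : ∀ x y : W, star x * x + star y * y = 0 → x = 0) (hA : IsJordanSubspace A)
    (C : Submodule ℝ W) : ∀ e ∈ A, e * e = e → peirceCorner A e = C →
    ∃ F : Finset W, (∀ f ∈ F, IsMinimalIdempotent A f) ∧
      (∀ f ∈ F, ∀ g ∈ F, f ≠ g → f * g = 0) ∧ ∑ f ∈ F, f = e := by
  classical
  induction C using WellFoundedLT.induction with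
  | ind C ih =>
  intro e he hee hC
  by_cases he0 : e = 0
  · exact ⟨∅, by simp, by simp, by simp [he0]⟩
  by_cases hmin : IsMinimalIdempotent A e
  · refine ⟨{e}, by simpa using hmin, ?_, by simp⟩
    intro f hf g hg hfg
    rw [Finset.mem_singleton] at hf hg
    exact absurd (hf.trans hg.symm) hfg
  obtain ⟨q, hq, hqq, hq0, hqe, heq, hqe'⟩ := hA.exists_sub_idempotent hW he hee he0 hmin
  have hlt : ∀ q ∈ A, q * q = q → q ≠ e → e * q = q → q * e = q → peirceCorner A q < C := by
    intro q hq hqq hqe heq hqe'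
    rw [← hC]
    refine lt_of_le_of_ne ?_ fun h => hqe ?_
    · rintro a ⟨h1, h2, h3⟩
      refine ⟨h1, ?_, ?_⟩
      · rw [← h2, ← mul_assoc, heq]
      · rw [← h3, mul_assoc, hqe']
    · have : e ∈ peirceCorner A q := by rw [h]; exact ⟨he, hee, hee⟩
      exact hqe'.symm.trans this.2.1
  have hq' : (e - q) * (e - q) = e - q := by
    rw [sub_mul, mul_sub, mul_sub, hee, heq, hqe', hqq]; abel
  obtain ⟨F, hF1, hF2, hF3⟩ := ih _ (hlt q hq hqq hqe heq hqe') q hq hqq rfl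
  obtain ⟨G, hG1, hG2, hG3⟩ := ih _ (hlt (e - q) (A.sub_mem he hq) hq'
    (fun h => hq0 (by simpa using h)) (by rw [mul_sub, hee, heq]) (by rw [sub_mul, hee, hqe']))
    (e - q) (A.sub_mem he hq) hq' rfl
  have key : ∀ (F : Finset W) (s : W), (∀ f ∈ F, IsMinimalIdempotent A f) →
      (∀ f ∈ F, ∀ g ∈ F, f ≠ g → f * g = 0) → ∑ f ∈ F, f = s →
      ∀ f ∈ F, f * s = f ∧ s * f = f := by
    intro F s h1 h2 h3 f hf
    rw [← h3, Finset.mul_sum, Finset.sum_mul, Finset.sum_eq_single f, Finset.sum_eq_single f]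
    · exact ⟨(h1 f hf).mul_self, (h1 f hf).mul_self⟩
    · exact fun g hg hgf => h2 g hg f hf hgf
    · exact fun h => absurd hf h
    · exact fun g hg hgf => h2 f hf g hg (Ne.symm hgf)
    · exact fun h => absurd hf h
  have hqd : q * (e - q) = 0 := by rw [mul_sub, hqe', hqq, sub_self]
  have hdq : (e - q) * q = 0 := by rw [sub_mul, heq, hqq, sub_self]
  have hFG : ∀ f ∈ F, ∀ g ∈ G, f * g = 0 := fun f hf g hg => by
    rw [← (key F q hF1 hF2 hF3 f hf).1, ← (key G _ hG1 hG2 hG3 g hg).2, mul_assoc,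
      ← mul_assoc q, hqd, zero_mul, mul_zero]
  have hGF : ∀ g ∈ G, ∀ f ∈ F, g * f = 0 := fun g hg f hf => by
    rw [← (key F q hF1 hF2 hF3 f hf).2, ← (key G _ hG1 hG2 hG3 g hg).1, mul_assoc,
      ← mul_assoc (e - q), hdq, zero_mul, mul_zero]
  have hdisj : Disjoint F G := by
    rw [Finset.disjoint_left]
    intro f hf hg
    exact (hF1 f hf).ne_zero ((hF1 f hf).mul_self ▸ hFG f hf f hg)
  refine ⟨F ∪ G, ?_, ?_, ?_⟩
  · intro f hf
    rcases Finset.mem_union.1 hf with h | h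
    exacts [hF1 f h, hG1 f h]
  · intro f hf g hg hfg
    rcases Finset.mem_union.1 hf with h | h <;> rcases Finset.mem_union.1 hg with h' | h'
    exacts [hF2 f h g h' hfg, hFG f h g h', hGF f h g h', hG2 f h g h' hfg]
  · rw [Finset.sum_union hdisj, hF3, hG3]; abel

/-- A frame of `A`: a finite family of pairwise orthogonal minimal idempotents with sum `1`. -/
structure IsJordanFrame {I : Type*} [Fintype I] (A : Submodule ℝ W) (p : I → W) : Prop where
  minimal : ∀ i, IsMinimalIdempotent A (p i)
  orthogonal : ∀ i j, i ≠ j → p i * p j = 0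
  sum_eq_one : ∑ i, p i = 1

theorem IsJordanSubspace.exists_frame [StarModule ℝ W] [FiniteDimensional ℝ W]
    (hW : ∀ x y : W, star x * x + star y * y = 0 → x = 0) (hA : IsJordanSubspace A) :
    ∃ F : Finset W, IsJordanFrame A (fun f : F => (f : W)) := by
  obtain ⟨F, h1, h2, h3⟩ := hA.exists_frame_of_idempotent hW _ 1 hA.one_mem (one_mul 1) rfl
  refine ⟨F, fun i => h1 i i.2, fun i j hij => h2 i i.2 j j.2 fun h => hij (Subtype.ext h), ?_⟩
  rw [← h3]
  exact Finset.sum_coe_sort F (fun f => f)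

end Frames

/-! ### Frames with at most two members give spin factors -/

section SmallFrames

variable {W : Type*} [Ring W] [StarRing W] [Algebra ℝ W] {A : Submodule ℝ W}

theorem IsMinimalIdempotent.eq_of_smul_eq {p : W} (hp : IsMinimalIdempotent A p) {c d : ℝ}
    (h : c • p = d • p) : c = d := by
  have : (c - d) • p = 0 := by rw [sub_smul, h, sub_self]
  exact sub_eq_zero.1 ((smul_eq_zero.1 this).resolve_right hp.ne_zero)

/-- For minimal idempotents `p`, `q` and `a` in `A`, the elements `p a q a p` and `q a p a q` are
the same multiple of `p` and of `q`. -/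
theorem IsMinimalIdempotent.exists_peirce_smul (hA : IsJordanSubspace A) {p q a : W}
    (hp : IsMinimalIdempotent A p) (hq : IsMinimalIdempotent A q) (ha : a ∈ A) :
    ∃ c : ℝ, p * a * q * a * p = c • p ∧ q * a * p * a * q = c • q := by
  obtain ⟨c, hc⟩ := hp.exists_smul _ (hA.mul_mul_mem ha hq.mem)
  obtain ⟨d, hd⟩ := hq.exists_smul _ (hA.mul_mul_mem ha hp.mem)
  simp only [← mul_assoc] at hc hd
  by_cases h0 : p * a * q = 0
  · have h1 : q * a * p = 0 := by
      have := congrArg star h0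
      simpa [hA.star_eq p hp.mem, hA.star_eq q hq.mem, hA.star_eq a ha, mul_assoc] using this
    exact ⟨0, by rw [h0]; simp, by rw [h1]; simp⟩
  · have e1 : (p * a * q * a * p) * (a * q) = c • (p * a * q) := by
      rw [hc, smul_mul_assoc, mul_assoc]
    have e2 : p * a * (q * a * p * a * q) = d • (p * a * q) := by
      rw [hd, mul_smul_comm]
    have e3 : (p * a * q * a * p) * (a * q) = p * a * (q * a * p * a * q) := by
      simp only [mul_assoc]
    rw [e3, e2] at e1
    have : (d - c) • (p * a * q) = 0 := by rw [sub_smul, e1, sub_self]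
    have := sub_eq_zero.1 ((smul_eq_zero.1 this).resolve_right h0)
    exact ⟨c, hc, by rw [hd, this]⟩

theorem IsMinimalIdempotent.isSpinFactor_of_eq_one (hA : IsJordanSubspace A)
    (h : IsMinimalIdempotent A (1 : W)) : IsSpinFactor A := by
  refine ⟨⊥, disjoint_bot_right, ?_, fun v hv => ⟨0, by simp [(Submodule.mem_bot ℝ).1 hv]⟩⟩
  rw [sup_bot_eq]
  refine le_antisymm ?_ fun a ha => ?_
  · rw [Submodule.span_singleton_le_iff_mem]; exact hA.one_mem
  · obtain ⟨c, hc⟩ := h.exists_smul a ha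
    rw [one_mul, mul_one] at hc
    exact Submodule.mem_span_singleton.2 ⟨c, hc.symm⟩

/-- As for `2 × 2` Hermitian matrices, the vector part consists of the elements whose diagonal
coefficients at `p` and `q` are opposite. -/
theorem IsMinimalIdempotent.isSpinFactor_of_add_eq_one (hA : IsJordanSubspace A) {p q : W}
    (hp : IsMinimalIdempotent A p) (hq : IsMinimalIdempotent A q)
    (h1 : p + q = 1) : IsSpinFactor A := by
  refine ⟨{ carrier := {a | a ∈ A ∧ ∃ s : ℝ, p * a * p = s • p ∧ q * a * q = (-s) • q}
            add_mem' := ?_, zero_mem' := ⟨A.zero_mem, 0, by simp, by simp⟩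
            smul_mem' := ?_ }, ?_, ?_, ?_⟩
  · rintro a b ⟨ha, s, h2, h3⟩ ⟨hb, t, h4, h5⟩
    refine ⟨A.add_mem ha hb, s + t, ?_, ?_⟩
    · rw [mul_add, add_mul, h2, h4, add_smul]
    · rw [mul_add, add_mul, h3, h5, neg_add, add_smul]
  · rintro c a ⟨ha, s, h2, h3⟩
    refine ⟨A.smul_mem c ha, c * s, ?_, ?_⟩
    · rw [mul_smul_comm, smul_mul_assoc, h2, smul_smul]
    · rw [mul_smul_comm, smul_mul_assoc, h3, smul_smul, mul_neg]
  · rw [Submodule.disjoint_def]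
    rintro x hx ⟨-, s, h2, h3⟩
    obtain ⟨c, rfl⟩ := Submodule.mem_span_singleton.1 hx
    rw [mul_smul_comm, mul_one, smul_mul_assoc, hp.mul_self] at h2
    rw [mul_smul_comm, mul_one, smul_mul_assoc, hq.mul_self] at h3
    have h4 := hp.eq_of_smul_eq h2
    have h5 := hq.eq_of_smul_eq h3
    rw [show c = 0 by linarith, zero_smul]
  · refine le_antisymm (sup_le ?_ fun x hx => hx.1) fun a ha => ?_
    · rw [Submodule.span_singleton_le_iff_mem]; exact hA.one_mem
    · obtain ⟨s, hs⟩ := hp.exists_smul a ha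
      obtain ⟨t, ht⟩ := hq.exists_smul a ha
      have e : a = ((s + t) / 2) • (1 : W) + (a - ((s + t) / 2) • (1 : W)) := by abel
      rw [e]
      refine Submodule.add_mem_sup (Submodule.mem_span_singleton.2 ⟨_, rfl⟩)
        ⟨A.sub_mem ha (A.smul_mem _ hA.one_mem), (s - t) / 2, ?_, ?_⟩
      · rw [mul_sub, sub_mul, mul_smul_comm, mul_one, smul_mul_assoc, hs, hp.mul_self, ← sub_smul]
        congr 1; ring
      · rw [mul_sub, sub_mul, mul_smul_comm, mul_one, smul_mul_assoc, ht, hq.mul_self, ← sub_smul]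
        congr 1; ring
  · rintro v ⟨hv, s, h2, h3⟩
    obtain ⟨c, h4, h5⟩ := hp.exists_peirce_smul hA hq hv
    refine ⟨s * s + c, ?_⟩
    -- Peirce decomposition of `v²`: each diagonal block has coefficient `s² + c`, and the
    -- off-diagonal terms cancel because the diagonal coefficients of `v` are `s` and `-s`.
    have e : v * v = (p * v * p) * (p * v * p) + p * v * q * v * p + (q * v * q) * (q * v * q)
        + q * v * p * v * q + ((p * v * p) * v * q + p * v * (q * v * q))
        + ((q * v * q) * v * p + q * v * (p * v * p)) := by
      have e1 : ∀ x y : W, x * y = x * p * y + x * q * y := fun x y => by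
        rw [← add_mul, ← mul_add, h1, mul_one]
      calc v * v = (p + q) * (v * v) * (p + q) := by rw [h1, one_mul, mul_one]
        _ = (p + q) * (v * p * v + v * q * v) * (p + q) := by rw [← e1]
        _ = p * v * (p * p) * v * p + p * v * q * v * p + (q * v * (q * q) * v * q)
        + q * v * p * v * q + ((p * v * p) * v * q + p * v * (q * v * q))
        + ((q * v * q) * v * p + q * v * (p * v * p)) := by
          rw [hp.mul_self, hq.mul_self]; noncomm_ring
        _ = _ := by noncomm_ring
    rw [e, h2, h3, h4, h5]
    simp only [hp.mul_self, hq.mul_self, smul_mul_assoc, mul_smul_comm]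
    rw [← h1]
    module

end SmallFrames

/-! ### Connectedness of frames in a simple Jordan algebra -/

section Connected

variable {W : Type*} [Ring W] [StarRing W] [Algebra ℝ W] {A : Submodule ℝ W}

theorem IsJordanFrame.mul_eq_ite {I : Type*} [Fintype I] [DecidableEq I] {p : I → W}
    (hp : IsJordanFrame A p) (i j : I) : p i * p j = if i = j then p i else 0 := by
  split_ifs with h
  · rw [← h, (hp.minimal i).mul_self]
  · exact hp.orthogonal i j h

/-- In a simple Jordan algebra any two members of a frame are connected. -/
theorem IsJordanFrame.exists_peirce_ne_zero
    (hW : ∀ x y : W, star x * x + star y * y = 0 → x = 0) (hA : IsJordanSubspace A)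
    (hsimple : IsSimpleJordan A) {I : Type*} [Fintype I] {p : I → W}
    (hp : IsJordanFrame A p) (o k : I) : ∃ a ∈ A, p o * a * p k ≠ 0 := by
  classical
  by_contra hcon
  push Not at hcon
  -- The indices connected to `o`. Were `k` not among them, the sum `e` of their idempotents would
  -- be a central idempotent other than `0` and `1`.
  set C : Finset I := Finset.univ.filter fun j => ∃ a ∈ A, p o * a * p j ≠ 0 with hC
  have hoC : o ∈ C := by
    simp only [hC, Finset.mem_filter, Finset.mem_univ, true_and]
    exact ⟨1, hA.one_mem, by rw [mul_one, (hp.minimal o).mul_self]; exact (hp.minimal o).ne_zero⟩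
  have hkC : k ∉ C := by
    simpa [hC] using hcon
  set e := ∑ j ∈ C, p j with he
  have hpe : ∀ j, p j * e = if j ∈ C then p j else 0 := fun j => by
    rw [he, Finset.mul_sum]
    simp [hp.mul_eq_ite]
  have hep : ∀ j, e * p j = if j ∈ C then p j else 0 := fun j => by
    rw [he, Finset.sum_mul]
    simp [hp.mul_eq_ite]
  have hee : e * e = e := by
    conv_lhs => rhs; rw [he]
    rw [Finset.mul_sum]
    exact Finset.sum_congr rfl fun j hj => by rw [hep, if_pos hj]
  have heA : e ∈ A := A.sum_mem fun j _ => (hp.minimal j).mem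
  have hoff : ∀ j ∈ C, ∀ l, l ∉ C → ∀ a ∈ A, p j * a * p l = 0 := by
    intro j hj l hl a ha
    by_contra hne
    obtain ⟨x, hx, hxj⟩ := (Finset.mem_filter.1 hj).2
    apply hl
    refine Finset.mem_filter.2 ⟨Finset.mem_univ _, ?_⟩
    by_cases hoj : o = j
    · exact ⟨a, ha, hoj ▸ hne⟩
    have hlj : p l * p j = 0 := hp.orthogonal l j fun h => hl (h ▸ hj)
    have hol : p o * p l = 0 := hp.orthogonal o l fun h => hl (h ▸ hoC)
    have hjl : p j * p l = 0 := hp.orthogonal j l fun h => hl (h ▸ hj)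
    have hoj' : p o * p j = 0 := hp.orthogonal o j hoj
    -- Connection is transitive: the Jordan product of the `(o, j)` part of `x` and the `(j, l)`
    -- part of `a` has `(o, l)` block `p o x p j a p l`, nonzero because `p j x p o x p j` is a
    -- nonzero multiple of `p j`.
    have hx' := hA.triple_mem (hp.minimal o).mem hx (hp.minimal j).mem
    have ha' := hA.triple_mem (hp.minimal j).mem ha (hp.minimal l).mem
    refine ⟨_, hA.mul_add_mul_mem _ hx' _ ha', fun h0 => ?_⟩
    obtain ⟨c, -, hc⟩ := (hp.minimal o).exists_peirce_smul hA (hp.minimal j) hx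
    have hc0 : c ≠ 0 := fun hc0 => hxj <| by
      apply eq_zero_of_star_mul_self_eq_zero hW
      rw [star_mul, star_mul, hA.star_eq _ hx, hA.star_eq _ (hp.minimal o).mem,
        hA.star_eq _ (hp.minimal j).mem]
      rw [hc0, zero_smul] at hc
      rw [← hc]
      conv_rhs => rw [← (hp.minimal o).mul_self]
      simp only [mul_assoc]
    have h1 : p o * (x * (p j * (a * p l))) = 0 := by
      have e1 : ∀ z, p o * (p j * z) = 0 := fun z => by rw [← mul_assoc, hoj', zero_mul]
      have e2 : ∀ z, p o * (p l * z) = 0 := fun z => by rw [← mul_assoc, hol, zero_mul]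
      have e3 : ∀ z, p o * (p o * z) = p o * z := fun z => by
        rw [← mul_assoc, (hp.minimal o).mul_self]
      have e4 : ∀ z, p j * (p j * z) = p j * z := fun z => by
        rw [← mul_assoc, (hp.minimal j).mul_self]
      have e5 : ∀ z, p j * (p l * z) = 0 := fun z => by rw [← mul_assoc, hjl, zero_mul]
      have e6 := (hp.minimal l).mul_self
      simpa only [mul_add, add_mul, mul_assoc, e1, e2, e3, e4, e5, e6, mul_zero, zero_add,
        add_zero, hjl] using h0
    have h2 : c • (p j * (a * p l)) = 0 := by
      calc _ = p j * x * p o * x * p j * (a * p l) := by rw [hc, smul_mul_assoc]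
        _ = p j * x * (p o * (x * (p j * (a * p l)))) := by simp only [mul_assoc]
        _ = 0 := by rw [h1, mul_zero]
    rw [← mul_assoc] at h2
    exact hne ((smul_eq_zero.1 h2).resolve_left hc0)
  have hcompl : (1 : W) = e + ∑ l ∈ Cᶜ, p l := by
    rw [he, Finset.sum_add_sum_compl, hp.sum_eq_one]
  have hoff' : ∀ a ∈ A, e * a = e * a * e := by
    intro a ha
    have : e * a * ∑ l ∈ Cᶜ, p l = 0 := by
      rw [he, Finset.sum_mul, Finset.sum_mul_sum]
      exact Finset.sum_eq_zero fun j hj => Finset.sum_eq_zero fun l hl =>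
        hoff j hj l (Finset.mem_compl.1 hl) a ha
    calc e * a = e * a * 1 := (mul_one _).symm
      _ = _ := by rw [hcompl, mul_add, this, add_zero]
  have hoff'' : ∀ a ∈ A, a * e = e * (a * e) := by
    intro a ha
    have := congrArg star (hoff' a ha)
    simpa [hA.star_eq _ ha, hA.star_eq _ heA] using this
  -- The blocks between `C` and its complement vanish, so `e` commutes with `A` and `eAe` is a
  -- Jordan ideal.
  have hI := hsimple.2 (peirceCorner A e) (fun x hx => hx.1) ?_
  · have heI : e ∈ peirceCorner A e := ⟨heA, hee, hee⟩
    rcases hI with h | h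
    · rw [h, Submodule.mem_bot] at heI
      have := hep o
      rw [if_pos hoC, heI, zero_mul] at this
      exact (hp.minimal o).ne_zero this.symm
    · have h1 : (1 : W) ∈ peirceCorner A e := by rw [h]; exact hA.one_mem
      have h2 : e = 1 := by rw [← mul_one e]; exact h1.2.1
      have := hep k
      rw [if_neg hkC, h2, one_mul] at this
      exact (hp.minimal k).ne_zero this
  · rintro a ha x ⟨hx, h1, h2⟩
    rw [jordanMul]
    refine Submodule.smul_mem _ _ ⟨hA.mul_add_mul_mem a ha x hx, ?_, ?_⟩
    · have : e * (a * x) = a * x := by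
        rw [← h1, ← mul_assoc a, hoff'' a ha, ← mul_assoc, ← mul_assoc, hee]
      rw [mul_add, this, ← mul_assoc e x, h1]
    · have : x * a * e = x * a := by
        rw [← h2, mul_assoc x, hoff' a ha, mul_assoc x, mul_assoc, hee]
      rw [add_mul, this, mul_assoc a, h2]

end Connected

/-! ### Coordinatisation in degree at least three -/

section MatrixUnits

variable {W : Type*} [Ring W] [StarRing W] [Algebra ℝ W] {A : Submodule ℝ W}
  {I : Type*} [Fintype I]

/-- The first row `u` of a system of matrix units `star (u i) * u j`, whose real parts lie in
`A`. -/
structure IsMatrixRow (A : Submodule ℝ W) (p : W) (u : I → W) : Prop where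
  minimal : IsMinimalIdempotent A p
  minimal_star_mul : ∀ i, IsMinimalIdempotent A (star (u i) * u i)
  mul_star_self : ∀ i, u i * star (u i) = p
  mul_star : ∀ i j, i ≠ j → u i * star (u j) = 0
  sum_star_mul : ∑ i, star (u i) * u i = 1
  left_mul : ∀ i, p * u i = u i
  mem : ∀ i j, i ≠ j → star (u i) * u j + star (u j) * u i ∈ A

/-- The connecting block `p o a p j` is a multiple of a partial isometry between the two
idempotents; dividing by the square root of its coefficient normalises it. -/
theorem IsJordanFrame.exists_row_entry [StarModule ℝ W]
    (hW : ∀ x y : W, star x * x + star y * y = 0 → x = 0) (hA : IsJordanSubspace A)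
    (hsimple : IsSimpleJordan A) {p : I → W} (hp : IsJordanFrame A p) (o j : I) :
    ∃ u : W, p o * u = u ∧ u * p j = u ∧ u * star u = p o ∧ star u * u = p j ∧ u + star u ∈ A ∧
      (j = o → u = p o) := by
  have ho := (hp.minimal o).mul_self
  have hj := (hp.minimal j).mul_self
  have hos := hA.star_eq _ (hp.minimal o).mem
  have hjs := hA.star_eq _ (hp.minimal j).mem
  by_cases hoj : j = o
  · subst hoj
    exact ⟨p j, ho, ho, by rw [hos, ho], by rw [hos, ho], by
      rw [hos]; exact A.add_mem (hp.minimal j).mem (hp.minimal j).mem, fun _ => rfl⟩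
  obtain ⟨a, ha, hne⟩ := hp.exists_peirce_ne_zero hW hA hsimple o j
  obtain ⟨c, h1, h2⟩ := (hp.minimal o).exists_peirce_smul hA (hp.minimal j) ha
  have has := hA.star_eq a ha
  have hs : star (p o * a * p j) = p j * a * p o := by
    rw [star_mul, star_mul, hos, hjs, has, mul_assoc]
  have h1' : (p o * a * p j) * (p j * a * p o) = c • p o := by
    rw [← h1]; conv_rhs => rw [← hj]
    simp only [mul_assoc]
  have h2' : (p j * a * p o) * (p o * a * p j) = c • p j := by
    rw [← h2]; conv_rhs => rw [← ho]
    simp only [mul_assoc]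
  -- If `c ≤ 0`, then `x* x + (√(-c) p j)² = 0` for the block `x`, contrary to positivity.
  have hc : 0 < c := by
    by_contra hc
    apply hne
    apply hW _ (Real.sqrt (-c) • p j)
    rw [hs, h2', star_smul, hjs, star_trivial, smul_mul_smul_comm, hj,
      Real.mul_self_sqrt (by linarith), ← add_smul, add_neg_cancel, zero_smul]
  have hcc : (Real.sqrt c)⁻¹ * (Real.sqrt c)⁻¹ * c = 1 := by
    rw [← mul_inv, Real.mul_self_sqrt hc.le, inv_mul_cancel₀ hc.ne']
  refine ⟨(Real.sqrt c)⁻¹ • (p o * a * p j), ?_, ?_, ?_, ?_, ?_, fun h => absurd h hoj⟩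
  · rw [mul_smul_comm, ← mul_assoc, ← mul_assoc, ho]
  · rw [smul_mul_assoc, mul_assoc _ (p j), hj]
  · rw [star_smul, hs, star_trivial, smul_mul_smul_comm, h1', smul_smul, hcc, one_smul]
  · rw [star_smul, hs, star_trivial, smul_mul_smul_comm, h2', smul_smul, hcc, one_smul]
  · rw [star_smul, hs, star_trivial, ← smul_add]
    exact A.smul_mem _ (hA.triple_mem (hp.minimal o).mem ha (hp.minimal j).mem)

theorem IsJordanFrame.exists_matrixRow [StarModule ℝ W]
    (hW : ∀ x y : W, star x * x + star y * y = 0 → x = 0) (hA : IsJordanSubspace A)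
    (hsimple : IsSimpleJordan A) {p : I → W} (hp : IsJordanFrame A p) (o : I) :
    ∃ u : I → W, IsMatrixRow A (p o) u := by
  choose u h1 h2 h3 h4 h5 h6 using hp.exists_row_entry hW hA hsimple o
  have hps := fun i => hA.star_eq _ (hp.minimal i).mem
  have h1' : ∀ i, star (u i) * p o = star (u i) := fun i => by
    have := congrArg star (h1 i)
    rwa [star_mul, hps] at this
  have h2' : ∀ i, p i * star (u i) = star (u i) := fun i => by
    have := congrArg star (h2 i)
    rwa [star_mul, hps] at this
  refine ⟨u, hp.minimal o, fun i => (h4 i).symm ▸ hp.minimal i, h3, fun i j hij => ?_, ?_, h1,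
    fun i j hij => ?_⟩
  · rw [← h2 i, ← h2' j, mul_assoc, ← mul_assoc (p i), hp.orthogonal i j hij, zero_mul, mul_zero]
  · simp only [h4, hp.sum_eq_one]
  · by_cases hi : i = o
    · rw [h6 i hi, hps, h1, h1']; exact h5 j
    by_cases hj : j = o
    · rw [h6 j hj, hps, h1, h1', add_comm]; exact h5 i
    -- In the Jordan product of `u i + (u i)*` and `u j + (u j)*` only the wanted terms `(u i)* u j`
    -- and `(u j)* u i` survive.
    have z1 : ∀ i j, i ≠ o → u i * u j = 0 := fun i j hi => by
      rw [← h2 i, ← h1 j, mul_assoc, ← mul_assoc (p i), hp.orthogonal i o hi, zero_mul, mul_zero]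
    have z2 : ∀ i j, j ≠ o → star (u i) * star (u j) = 0 := fun i j hj => by
      rw [← star_mul, z1 j i hj, star_zero]
    have z3 : ∀ i j, i ≠ j → u i * star (u j) = 0 := fun i j hij => by
      rw [← h2 i, ← h2' j, mul_assoc, ← mul_assoc (p i), hp.orthogonal i j hij, zero_mul,
        mul_zero]
    have := hA.mul_add_mul_mem _ (h5 i) _ (h5 j)
    simpa only [add_mul, mul_add, z1 i j hi, z2 i j hj, z1 j i hj, z2 j i hi, z3 i j hij,
      z3 j i (Ne.symm hij), zero_add, add_zero] using this

/-- Membership in the coordinate algebra of `A` with respect to a row of matrix units. -/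
def IsJordanCoordinate (A : Submodule ℝ W) (p : W) (u : I → W) (d : W) : Prop :=
  p * d = d ∧ d * p = d ∧ ∀ i j, i ≠ j → star (u i) * d * u j + star (u j) * star d * u i ∈ A

variable {p : W} {u : I → W}

theorem IsJordanCoordinate.star (hA : IsJordanSubspace A) (hp : p ∈ A) {d : W}
    (hd : IsJordanCoordinate A p u d) : IsJordanCoordinate A p u (star d) := by
  refine ⟨?_, ?_, fun i j hij => ?_⟩
  · have := congrArg Star.star hd.2.1
    rwa [star_mul, hA.star_eq p hp] at this
  · have := congrArg Star.star hd.1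
    rwa [star_mul, hA.star_eq p hp] at this
  · rw [star_star, add_comm]; exact hd.2.2 j i (Ne.symm hij)

theorem IsJordanCoordinate.add {d f : W}
    (hd : IsJordanCoordinate A p u d) (hf : IsJordanCoordinate A p u f) :
    IsJordanCoordinate A p u (d + f) := by
  refine ⟨by rw [mul_add, hd.1, hf.1], by rw [add_mul, hd.2.1, hf.2.1], fun i j hij => ?_⟩
  have := A.add_mem (hd.2.2 i j hij) (hf.2.2 i j hij)
  rw [star_add]
  convert this using 1
  noncomm_ring

theorem IsJordanCoordinate.smul [StarModule ℝ W] (c : ℝ) {d : W}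
    (hd : IsJordanCoordinate A p u d) : IsJordanCoordinate A p u (c • d) := by
  refine ⟨by rw [mul_smul_comm, hd.1], by rw [smul_mul_assoc, hd.2.1], fun i j hij => ?_⟩
  have := A.smul_mem c (hd.2.2 i j hij)
  rw [star_smul, star_trivial c]
  simpa only [mul_smul_comm, smul_mul_assoc, smul_add] using this

namespace IsMatrixRow

variable (hu : IsMatrixRow A p u)
include hu

theorem star_mul_right (hA : IsJordanSubspace A) (i : I) : star (u i) * p = star (u i) := by
  have := congrArg star (hu.left_mul i)
  rwa [star_mul, hA.star_eq p hu.minimal.mem] at this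

theorem isJordanCoordinate_self (hA : IsJordanSubspace A) : IsJordanCoordinate A p u p := by
  refine ⟨hu.minimal.mul_self, hu.minimal.mul_self, fun i j hij => ?_⟩
  rw [hA.star_eq p hu.minimal.mem, hu.star_mul_right hA, hu.star_mul_right hA]
  exact hu.mem i j hij

theorem exists_third (h3 : 3 ≤ Fintype.card I) (i j : I) : ∃ k, k ≠ i ∧ k ≠ j := by
  classical
  by_contra h
  push Not at h
  have : (Finset.univ : Finset I) ⊆ {i, j} := fun k _ => by
    by_cases hk : k = i
    · simp [hk]
    · simp [h k hk]
  have := (Finset.card_le_card this).trans Finset.card_le_two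
  rw [Finset.card_univ] at this
  omega

theorem mul_star_assoc (i j : I) (hij : i ≠ j) (x : W) : u i * (star (u j) * x) = 0 := by
  rw [← mul_assoc, hu.mul_star i j hij, zero_mul]

theorem mul_star_self_assoc (i : I) (x : W) : u i * (star (u i) * x) = p * x := by
  rw [← mul_assoc, hu.mul_star_self i]

/-- This is where three idempotents are needed: the `(i, k)` entry `d` times the `(k, j)` entry `f`,
with `k` different from both, is the `(i, j)` entry `d f` of a Jordan product. -/
theorem coordinate_mul (hA : IsJordanSubspace A) (h3 : 3 ≤ Fintype.card I) {d f : W}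
    (hd : IsJordanCoordinate A p u d) (hf : IsJordanCoordinate A p u f) :
    IsJordanCoordinate A p u (d * f) := by
  have hd' := hd.star hA hu.minimal.mem
  have hf' := hf.star hA hu.minimal.mem
  refine ⟨by rw [← mul_assoc, hd.1], by rw [mul_assoc, hf.2.1], fun i j hij => ?_⟩
  obtain ⟨k, hki, hkj⟩ := hu.exists_third h3 i j
  have := hA.mul_add_mul_mem _ (hd.2.2 i k (Ne.symm hki)) _ (hf.2.2 k j hkj)
  have e1 : ∀ x, p * (f * x) = f * x := fun x => by rw [← mul_assoc, hf.1]
  have e2 : ∀ x, p * (star d * x) = star d * x := fun x => by rw [← mul_assoc, hd'.1]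
  simpa only [add_mul, mul_add, mul_assoc, star_mul, hu.mul_star_assoc i j hij,
    hu.mul_star_assoc j i (Ne.symm hij), hu.mul_star_assoc i k (Ne.symm hki),
    hu.mul_star_assoc k i hki, hu.mul_star_assoc k j hkj, hu.mul_star_assoc j k (Ne.symm hkj),
    hu.mul_star_self_assoc, e1, e2, mul_zero, zero_add, add_zero] using this

/-- The second index of an off-diagonal coordinate can be changed. -/
theorem coordinate_move (hA : IsJordanSubspace A) {d : W} (h2 : d * p = d)
    {i j k : I} (hij : i ≠ j) (hki : k ≠ i)
    (h : star (u i) * d * u j + star (u j) * star d * u i ∈ A) :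
    star (u i) * d * u k + star (u k) * star d * u i ∈ A := by
  by_cases hkj : k = j
  · rwa [hkj]
  have h2' : p * star d = star d := by
    have := congrArg star h2
    rwa [star_mul, hA.star_eq p hu.minimal.mem] at this
  have := hA.mul_add_mul_mem _ h _ (hu.mem j k (Ne.symm hkj))
  have e2 : ∀ x, p * (star d * x) = star d * x := fun x => by rw [← mul_assoc, h2']
  simpa only [add_mul, mul_add, mul_assoc, hu.mul_star_assoc i j hij,
    hu.mul_star_assoc j i (Ne.symm hij), hu.mul_star_assoc i k (Ne.symm hki),
    hu.mul_star_assoc k i hki, hu.mul_star_assoc k j hkj, hu.mul_star_assoc j k (Ne.symm hkj),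
    hu.mul_star_self_assoc, hu.left_mul, e2, mul_zero, zero_add, add_zero] using this

/-- The first index of an off-diagonal coordinate can be changed. -/
theorem coordinate_move_left (hA : IsJordanSubspace A) {d : W} (h1 : p * d = d)
    {i j k : I} (hij : i ≠ j) (hkj : k ≠ j)
    (h : star (u i) * d * u j + star (u j) * star d * u i ∈ A) :
    star (u k) * d * u j + star (u j) * star d * u k ∈ A := by
  have hps := hA.star_eq p hu.minimal.mem
  have h1' : star d * p = star d := by
    have := congrArg star h1
    rwa [star_mul, hps] at this
  have := hu.coordinate_move hA (d := star d) h1' (Ne.symm hij) hkj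
    (by rwa [star_star, add_comm])
  rwa [star_star, add_comm] at this

theorem isJordanCoordinate_of_exists (hA : IsJordanSubspace A) (h3 : 3 ≤ Fintype.card I) {d : W}
    (h1 : p * d = d) (h2 : d * p = d) {i j : I} (hij : i ≠ j)
    (h : star (u i) * d * u j + star (u j) * star d * u i ∈ A) : IsJordanCoordinate A p u d := by
  refine ⟨h1, h2, fun k l hkl => ?_⟩
  by_cases hkj : k = j
  -- Moving the first index directly to `j` would hit the diagonal, so the route is `(i, j) → (i, m)
  -- → (j, m) → (j, l)`.
  · obtain ⟨m, hmi, hmj⟩ := hu.exists_third h3 i j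
    subst hkj
    exact hu.coordinate_move hA h2 (Ne.symm hmj) (Ne.symm hkl)
      (hu.coordinate_move_left hA h1 (Ne.symm hmi) (Ne.symm hmj)
        (hu.coordinate_move hA h2 hij hmi h))
  · exact hu.coordinate_move hA h2 hkj (Ne.symm hkl)
      (hu.coordinate_move_left hA h1 hij hkj h)

/-- Minimality makes the diagonal coordinates real multiples of `p`; an off-diagonal one is carried
by a triple product in `A`. -/
theorem isJordanCoordinate_of_mem [StarModule ℝ W] (hA : IsJordanSubspace A)
    (h3 : 3 ≤ Fintype.card I) {a : W}
    (ha : a ∈ A) (i j : I) : IsJordanCoordinate A p u (u i * a * star (u j)) := by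
  have hr := hu.star_mul_right hA
  by_cases hij : i = j
  · subst hij
    obtain ⟨c, hc⟩ := (hu.minimal_star_mul i).exists_smul a ha
    have : u i * a * star (u i) = c • p := by
      calc u i * a * star (u i) = p * u i * a * (star (u i) * p) := by rw [hu.left_mul, hr]
        _ = u i * ((star (u i) * u i) * a * (star (u i) * u i)) * star (u i) := by
            rw [← hu.mul_star_self i]; simp only [mul_assoc]
        _ = c • p := by
            rw [hc, mul_smul_comm, smul_mul_assoc, mul_assoc, mul_assoc, hu.mul_star_self,
              hr, hu.mul_star_self]
    rw [this]
    exact (hu.isJordanCoordinate_self hA).smul c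
  · refine hu.isJordanCoordinate_of_exists hA h3 ?_ ?_ hij ?_
    · rw [← mul_assoc, ← mul_assoc, hu.left_mul]
    · rw [mul_assoc, hr]
    · have := hA.triple_mem (hu.minimal_star_mul i).mem ha (hu.minimal_star_mul j).mem
      simpa only [star_mul, star_star, hA.star_eq a ha, mul_assoc] using this

/-- The elements all of whose matrix coordinates lie in the coordinate algebra of `A`. -/
def coordinateSubalgebra [StarModule ℝ W] (hA : IsJordanSubspace A) (h3 : 3 ≤ Fintype.card I) :
    Subalgebra ℝ W where
  carrier := {z | ∀ i j, IsJordanCoordinate A p u (u i * z * star (u j))}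
  add_mem' := fun hx hy i j => by
    rw [mul_add, add_mul]; exact (hx i j).add (hy i j)
  mul_mem' := fun {x y} hx hy i j => by
    have e : u i * (x * y) * star (u j) =
        ∑ k, (u i * x * star (u k)) * (u k * y * star (u j)) := by
      calc _ = u i * x * 1 * y * star (u j) := by simp only [mul_assoc, one_mul]
        _ = _ := by
          rw [← hu.sum_star_mul, Finset.mul_sum, Finset.sum_mul, Finset.sum_mul]
          simp only [mul_assoc]
    rw [e]
    refine Finset.sum_induction _ (IsJordanCoordinate A p u) (fun _ _ => IsJordanCoordinate.add)
      ?_ fun k _ => hu.coordinate_mul hA h3 (hx i k) (hy k j)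
    have := (hu.isJordanCoordinate_self hA).smul 0
    rwa [zero_smul] at this
  algebraMap_mem' := fun c i j => by
    rw [Algebra.algebraMap_eq_smul_one]
    exact hu.isJordanCoordinate_of_mem hA h3 (A.smul_mem c hA.one_mem) i j

/-- A Jordan algebra of degree at least three contains all self-adjoint elements of its associative
envelope. -/
theorem mem_of_mem_adjoin [StarModule ℝ W] (hA : IsJordanSubspace A)
    (h3 : 3 ≤ Fintype.card I) {z : W} (hz : z ∈ Algebra.adjoin ℝ (A : Set W))
    (hs : star z = z) : z ∈ A := by
  have hle : Algebra.adjoin ℝ (A : Set W) ≤ hu.coordinateSubalgebra hA h3 :=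
    Algebra.adjoin_le fun a ha i j => hu.isJordanCoordinate_of_mem hA h3 ha i j
  have hD : ∀ i j, IsJordanCoordinate A p u (u i * z * star (u j)) := hle hz
  have hr := hu.star_mul_right hA
  have hps := hA.star_eq p hu.minimal.mem
  have e1 : z = ∑ i, ∑ j, star (u i) * (u i * z * star (u j)) * u j := by
    calc z = 1 * z * 1 := by rw [one_mul, mul_one]
      _ = _ := by
        rw [← hu.sum_star_mul, Finset.sum_mul, Finset.sum_mul_sum]
        simp only [mul_assoc]
  -- Pairing the `(i, j)` entry with its adjoint turns `2z` into a sum of elements of the form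
  -- covered by `IsJordanCoordinate`.
  have e2 : (2 : ℝ) • z = ∑ i, ∑ j, (star (u i) * (u i * z * star (u j)) * u j
      + star (u j) * star (u i * z * star (u j)) * u i) := by
    simp only [Finset.sum_add_distrib]
    rw [← e1, two_smul]
    congr 1
    rw [Finset.sum_comm]
    simp only [star_mul, star_star, hs]
    conv_lhs => rw [e1]
    simp only [mul_assoc]
  have h2 : (2 : ℝ) • z ∈ A := by
    rw [e2]
    refine A.sum_mem fun i _ => A.sum_mem fun j _ => ?_
    by_cases hij : i = j
    · subst hij
      obtain ⟨k, hk, -⟩ := hu.exists_third h3 i i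
      -- A diagonal entry `d` is placed at `(i, k)`, multiplied by the `(i, k)` unit and compressed
      -- to the `i`-th corner, which leaves `2 (u i)* d (u i)`.
      have := hA.mul_add_mul_mem _ ((hD i i).2.2 i k (Ne.symm hk)) _ (hu.mem i k (Ne.symm hk))
      have := hA.mul_mul_mem (hu.minimal_star_mul i).mem this
      have e3 := (hD i i).1
      have e4 := (hD i i).2.1
      set d := u i * z * star (u i) with hd
      have hds : star d = d := by rw [hd]; simp only [star_mul, star_star, hs, mul_assoc]
      have e3' : ∀ x, p * (d * x) = d * x := fun x => by rw [← mul_assoc, e3]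
      have e4' : ∀ x, d * (p * x) = d * x := fun x => by rw [← mul_assoc, e4]
      rw [hds] at this ⊢
      simpa only [add_mul, mul_add, mul_assoc, hu.mul_star_assoc i k (Ne.symm hk),
        hu.mul_star_assoc k i hk, hu.mul_star_self_assoc, hu.left_mul, e3', e4', mul_zero,
        zero_add, add_zero] using this
    · exact (hD i j).2.2 i j hij
  have := A.smul_mem (1 / 2 : ℝ) h2
  rwa [smul_smul, show (1 / 2 : ℝ) * 2 = 1 by norm_num, one_smul] at this

end IsMatrixRow

/-- A simple Jordan algebra that is no spin factor contains all self-adjoint elements of its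
associative envelope. -/
theorem IsJordanSubspace.mem_of_mem_adjoin [StarModule ℝ W] [FiniteDimensional ℝ W] [Nontrivial W]
    (hW : ∀ x y : W, star x * x + star y * y = 0 → x = 0) (hA : IsJordanSubspace A)
    (hsimple : IsSimpleJordan A) (hspin : ¬ IsSpinFactor A) {z : W}
    (hz : z ∈ Algebra.adjoin ℝ (A : Set W)) (hs : star z = z) : z ∈ A := by
  classical
  obtain ⟨F, hF⟩ := hA.exists_frame hW
  have hsum : ∑ f ∈ F, f = 1 := by rw [← hF.sum_eq_one]; exact (Finset.sum_coe_sort F id).symm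
  have hcard : 3 ≤ Fintype.card F := by
    rw [Fintype.card_coe]
    by_contra hlt
    apply hspin
    have : F.card = 0 ∨ F.card = 1 ∨ F.card = 2 := by omega
    rcases this with h | h | h
    · rw [Finset.card_eq_zero.1 h] at hsum
      simp at hsum
    · obtain ⟨f, rfl⟩ := Finset.card_eq_one.1 h
      rw [Finset.sum_singleton] at hsum
      have := hF.minimal ⟨f, by simp⟩
      rw [hsum] at this
      exact this.isSpinFactor_of_eq_one hA
    · obtain ⟨f, g, hfg, rfl⟩ := Finset.card_eq_two.1 h
      rw [Finset.sum_pair hfg] at hsum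
      exact (hF.minimal ⟨f, by simp⟩).isSpinFactor_of_add_eq_one hA (hF.minimal ⟨g, by simp⟩) hsum
  have : Nonempty F := Fintype.card_pos_iff.1 (by omega)
  obtain ⟨u, hu⟩ := hF.exists_matrixRow hW hA hsimple (Classical.arbitrary F)
  exact hu.mem_of_mem_adjoin hA hcard hz hs

end MatrixUnits

/-! ### The faithful trace on the product algebra -/

section RealTrace

/-- The real part of the trace. -/
noncomputable def reTrace (n : ℕ) : MatAlg n →ₗ[ℝ] ℝ :=
  Complex.reLm ∘ₗ Matrix.traceLinearMap (Fin n) ℝ ℂ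

theorem reTrace_apply {n : ℕ} (x : MatAlg n) : reTrace n x = (Matrix.trace x).re := rfl

theorem reTrace_mul_comm {n : ℕ} (x y : MatAlg n) : reTrace n (x * y) = reTrace n (y * x) := by
  rw [reTrace_apply, reTrace_apply, Matrix.trace_mul_comm]

theorem reTrace_star {n : ℕ} (x : MatAlg n) : reTrace n (star x) = reTrace n x := by
  rw [reTrace_apply, reTrace_apply, Matrix.star_eq_conjTranspose, Matrix.trace_conjTranspose]
  simp

theorem reTrace_star_mul_self {n : ℕ} (x : MatAlg n) :
    reTrace n (star x * x) = ∑ i, ∑ j, Complex.normSq (x j i) := by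
  simp [reTrace_apply, Matrix.trace, Matrix.mul_apply, Matrix.star_eq_conjTranspose,
    Complex.normSq_apply]

theorem reTrace_star_mul_self_nonneg {n : ℕ} (x : MatAlg n) : 0 ≤ reTrace n (star x * x) := by
  rw [reTrace_star_mul_self]
  exact Finset.sum_nonneg fun i _ => Finset.sum_nonneg fun j _ => Complex.normSq_nonneg _

theorem eq_zero_of_reTrace {n : ℕ} {x : MatAlg n} (h : reTrace n (star x * x) = 0) : x = 0 := by
  rw [reTrace_star_mul_self, Finset.sum_eq_zero_iff_of_nonneg fun i _ =>
    Finset.sum_nonneg fun j _ => Complex.normSq_nonneg _] at h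
  ext j i
  have := h i (Finset.mem_univ _)
  rw [Finset.sum_eq_zero_iff_of_nonneg fun j _ => Complex.normSq_nonneg _] at this
  exact Complex.normSq_eq_zero.1 (this j (Finset.mem_univ _))

variable {n : ℕ} {ι : Type*} [Fintype ι] {m : ι → ℕ}

/-- The real part of the trace on the product of `M_n(ℂ)` and a semisimple algebra. -/
noncomputable def prodReTrace (n : ℕ) {ι : Type*} [Fintype ι] (m : ι → ℕ) :
    MatAlg n × SumMatAlg m →ₗ[ℝ] ℝ :=
  reTrace n ∘ₗ LinearMap.fst ℝ _ _ +
    ∑ i, reTrace (m i) ∘ₗ LinearMap.proj i ∘ₗ LinearMap.snd ℝ (MatAlg n) (SumMatAlg m)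

theorem prodReTrace_apply (x : MatAlg n × SumMatAlg m) :
    prodReTrace n m x = reTrace n x.1 + ∑ i, reTrace (m i) (x.2 i) := by
  simp [prodReTrace]

theorem prodReTrace_mul_comm (x y : MatAlg n × SumMatAlg m) :
    prodReTrace n m (x * y) = prodReTrace n m (y * x) := by
  simp only [prodReTrace_apply, Prod.fst_mul, Prod.snd_mul, Pi.mul_apply]
  rw [reTrace_mul_comm]
  congr 1
  exact Finset.sum_congr rfl fun i _ => reTrace_mul_comm _ _

theorem prodReTrace_star (x : MatAlg n × SumMatAlg m) :
    prodReTrace n m (star x) = prodReTrace n m x := by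
  simp only [prodReTrace_apply, Prod.fst_star, Prod.snd_star, Pi.star_apply, reTrace_star]

theorem prodReTrace_star_mul_self_nonneg (x : MatAlg n × SumMatAlg m) :
    0 ≤ prodReTrace n m (star x * x) := by
  rw [prodReTrace_apply]
  exact add_nonneg (reTrace_star_mul_self_nonneg _)
    (Finset.sum_nonneg fun i _ => reTrace_star_mul_self_nonneg _)

theorem eq_zero_of_prodReTrace {x : MatAlg n × SumMatAlg m}
    (h : prodReTrace n m (star x * x) = 0) : x = 0 := by
  rw [prodReTrace_apply] at h
  have h1 : 0 ≤ reTrace n (star x * x).1 := reTrace_star_mul_self_nonneg _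
  have h2 : ∀ i ∈ Finset.univ, 0 ≤ reTrace (m i) ((star x * x).2 i) :=
    fun i _ => reTrace_star_mul_self_nonneg _
  have h3 := Finset.sum_nonneg h2
  refine Prod.ext (eq_zero_of_reTrace (by linarith : reTrace n (star x * x).1 = 0)) ?_
  funext i
  have h4 := (Finset.sum_eq_zero_iff_of_nonneg h2).1 (by linarith) i (Finset.mem_univ _)
  exact eq_zero_of_reTrace h4

theorem eq_zero_of_star_mul_add_star_mul (x y : MatAlg n × SumMatAlg m)
    (h : star x * x + star y * y = 0) : x = 0 := by
  apply eq_zero_of_prodReTrace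
  have := congrArg (prodReTrace n m) h
  rw [map_add, map_zero] at this
  linarith [prodReTrace_star_mul_self_nonneg x, prodReTrace_star_mul_self_nonneg y]

end RealTrace

theorem star_mem_adjoin_of_star_eq {W : Type*} [Ring W] [StarRing W] [Algebra ℝ W]
    [StarModule ℝ W] {s : Set W} (hs : ∀ a ∈ s, star a = a) {x : W}
    (hx : x ∈ Algebra.adjoin ℝ s) : star x ∈ Algebra.adjoin ℝ s := by
  induction hx using Algebra.adjoin_induction with
  | mem a ha => rw [hs a ha]; exact Algebra.subset_adjoin ha
  | algebraMap r =>
    rw [← algebraMap_star_comm]; exact Subalgebra.algebraMap_mem _ _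
  | add x y _ _ hx hy => rw [star_add]; exact add_mem hx hy
  | mul x y _ _ hx hy => rw [star_mul]; exact mul_mem hy hx

/-! ### The graph of a Jordan homomorphism -/

section Graph

variable {R S : Type*} [Ring R] [StarRing R] [Algebra ℝ R] [Ring S] [StarRing S] [Algebra ℝ S]
  {A : Submodule ℝ R}

/-- The graph of a linear map on a subspace, as a subspace of the product algebra. -/
def jordanGraph (g : A →ₗ[ℝ] S) : Submodule ℝ (R × S) := LinearMap.range (A.subtype.prod g)

theorem mem_jordanGraph {g : A →ₗ[ℝ] S} {x : R × S} :
    x ∈ jordanGraph g ↔ ∃ a : A, ((a : R), g a) = x := Iff.rfl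

theorem jordanGraph_ext {g : A →ₗ[ℝ] S} {x y : R × S} (hx : x ∈ jordanGraph g)
    (hy : y ∈ jordanGraph g) (h : x.1 = y.1) : x = y := by
  obtain ⟨a, rfl⟩ := mem_jordanGraph.1 hx
  obtain ⟨b, rfl⟩ := mem_jordanGraph.1 hy
  rw [Subtype.ext h]

theorem map_fst_jordanGraph (g : A →ₗ[ℝ] S) :
    (jordanGraph g).map (LinearMap.fst ℝ R S) = A := by
  ext x
  simp only [Submodule.mem_map, mem_jordanGraph]
  constructor
  · rintro ⟨_, ⟨a, rfl⟩, rfl⟩; exact a.2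
  · intro hx; exact ⟨_, ⟨⟨x, hx⟩, rfl⟩, rfl⟩

theorem isJordanSubspace_jordanGraph (hA : IsJordanSubspace A) {g : A →ₗ[ℝ] S}
    (h1 : g ⟨1, hA.one_mem⟩ = 1) (hs : ∀ a, star (g a) = g a)
    (hmul : ∀ a b c : A, (c : R) = a * b + b * a → g c = g a * g b + g b * g a) :
    IsJordanSubspace (jordanGraph g) where
  one_mem := ⟨⟨1, hA.one_mem⟩, Prod.ext rfl h1⟩
  star_eq := by
    rintro _ ⟨a, rfl⟩
    exact Prod.ext (hA.star_eq a a.2) (hs a)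
  mul_add_mul_mem := by
    rintro _ ⟨a, rfl⟩ _ ⟨b, rfl⟩
    exact ⟨⟨_, hA.mul_add_mul_mem a a.2 b b.2⟩, Prod.ext rfl (hmul a b _ rfl)⟩

/-- The first projection is a Jordan isomorphism of the graph onto `A`, so ideals correspond. -/
theorem isSimpleJordan_jordanGraph (hA : IsSimpleJordan A) (g : A →ₗ[ℝ] S) :
    IsSimpleJordan (jordanGraph g) := by
  refine ⟨fun h => hA.1 ?_, fun I hI hmul => ?_⟩
  · rw [← map_fst_jordanGraph g, h, Submodule.map_bot]
  · have hideal : ∀ a ∈ A, ∀ x ∈ I.map (LinearMap.fst ℝ R S),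
        jordanMul a x ∈ I.map (LinearMap.fst ℝ R S) := by
      rintro a ha _ ⟨x, hx, rfl⟩
      exact ⟨_, hmul _ ⟨⟨a, ha⟩, rfl⟩ x hx, rfl⟩
    rcases hA.2 (I.map (LinearMap.fst ℝ R S))
      ((Submodule.map_mono hI).trans (map_fst_jordanGraph g).le) hideal with h | h
    · left
      rw [eq_bot_iff]
      intro x hx
      have : x.1 ∈ I.map (LinearMap.fst ℝ R S) := ⟨x, hx, rfl⟩
      rw [h, Submodule.mem_bot] at this
      exact jordanGraph_ext (hI hx) (Submodule.zero_mem _) this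
    · right
      refine le_antisymm hI ?_
      rintro _ ⟨a, rfl⟩
      have : (a : R) ∈ I.map (LinearMap.fst ℝ R S) := by rw [h]; exact a.2
      obtain ⟨x, hx, hxa⟩ := this
      have e : x = (A.subtype.prod g) a := jordanGraph_ext (hI hx) ⟨a, rfl⟩ hxa
      exact e ▸ hx

theorem isSpinFactor_of_jordanGraph {g : A →ₗ[ℝ] S} (h1 : (1 : R × S) ∈ jordanGraph g)
    (h : IsSpinFactor (jordanGraph g)) : IsSpinFactor A := by
  obtain ⟨V, hdisj, hsup, hsq⟩ := h
  refine ⟨V.map (LinearMap.fst ℝ R S), ?_, ?_, ?_⟩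
  · rw [Submodule.disjoint_def] at hdisj ⊢
    rintro _ hx ⟨v, hv, rfl⟩
    obtain ⟨c, hc⟩ := Submodule.mem_span_singleton.1 hx
    have hvG : v ∈ jordanGraph g := by rw [← hsup]; exact Submodule.mem_sup_right hv
    have e : c • (1 : R × S) = v := jordanGraph_ext (Submodule.smul_mem _ c h1) hvG hc
    have := hdisj v (Submodule.mem_span_singleton.2 ⟨c, e⟩) hv
    rw [this]; rfl
  · rw [← map_fst_jordanGraph g, ← hsup, Submodule.map_sup, Submodule.map_span]
    simp
  · rintro _ ⟨v, hv, rfl⟩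
    obtain ⟨c, hc⟩ := hsq v hv
    exact ⟨c, congrArg Prod.fst hc⟩

end Graph

/-- The associative envelope of the graph of a Jordan homomorphism on a simple Jordan algebra that
is no spin factor is again a graph. -/
theorem eq_zero_of_mem_adjoin_jordanGraph {n : ℕ} {ι : Type*} [Fintype ι] {m : ι → ℕ}
    {A : Submodule ℝ (MatAlg n)} (hn : n ≠ 0) (hsimple : IsSimpleJordan A)
    (hspin : ¬ IsSpinFactor A) {g : A →ₗ[ℝ] SumMatAlg m} (hG : IsJordanSubspace (jordanGraph g))
    {x : MatAlg n × SumMatAlg m}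
    (hx : x ∈ Algebra.adjoin ℝ (jordanGraph g : Set (MatAlg n × SumMatAlg m))) (hx1 : x.1 = 0) :
    x = 0 := by
  have : NeZero n := ⟨hn⟩
  have hmem : ∀ z ∈ Algebra.adjoin ℝ (jordanGraph g : Set (MatAlg n × SumMatAlg m)),
      star z = z → z.1 = 0 → z = 0 := fun z hz hs h1 =>
    jordanGraph_ext (hG.mem_of_mem_adjoin eq_zero_of_star_mul_add_star_mul
      (isSimpleJordan_jordanGraph hsimple g)
      (fun h => hspin (isSpinFactor_of_jordanGraph hG.one_mem h)) hz hs) (Submodule.zero_mem _) h1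
  have hsx := star_mem_adjoin_of_star_eq hG.star_eq hx
  have h := hmem _ (mul_mem hsx hx) (by rw [star_mul, star_star]) (by simp [hx1])
  exact eq_zero_of_star_mul_self_eq_zero eq_zero_of_star_mul_add_star_mul h

/-! ### Traces on Clifford systems -/

section Clifford

variable {W : Type*} [Ring W] [StarRing W] [Algebra ℝ W] {d : ℕ}

/-- Self-adjoint anticommuting square roots of `1`. -/
structure IsCliffordSystem (f : Fin d → W) : Prop where
  star_eq : ∀ i, star (f i) = f i
  mul_self : ∀ i, f i * f i = 1
  anticomm : ∀ i j, i ≠ j → f i * f j = -(f j * f i)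

variable {f : Fin d → W}

namespace IsCliffordSystem

variable (hf : IsCliffordSystem f)
include hf

theorem prod_mul {j : Fin d} {l : List (Fin d)} (hj : j ∉ l) :
    (l.map f).prod * f j = (-1 : ℝ) ^ l.length • (f j * (l.map f).prod) := by
  induction l with
  | nil => simp
  | cons a l ih =>
    rw [List.mem_cons, not_or] at hj
    rw [List.map_cons, List.prod_cons, mul_assoc, ih hj.2, mul_smul_comm, ← mul_assoc,
      hf.anticomm a j (Ne.symm hj.1), List.length_cons, pow_succ]
    simp [mul_assoc]

/-- A repeated generator is moved next to its twin at the cost of a sign, and its square is `1`. -/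
theorem exists_nodup_prod (l : List (Fin d)) :
    ∃ (l' : List (Fin d)) (s : ℝ), l'.Nodup ∧ (l.map f).prod = s • (l'.map f).prod := by
  induction l with
  | nil => exact ⟨[], 1, by simp, by simp⟩
  | cons a l ih =>
    obtain ⟨l', s, hl', h⟩ := ih
    by_cases ha : a ∈ l'
    · obtain ⟨u, t, rfl⟩ := List.append_of_mem ha
      have hau : a ∉ u := fun h => by
        have := List.nodup_append.1 hl'
        exact this.2.2 a h a (by simp) rfl
      refine ⟨u ++ t, s * (-1) ^ u.length, ?_, ?_⟩
      · exact hl'.sublist (List.Sublist.append_left (List.sublist_cons_self a t) u)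
      · rw [List.map_cons, List.prod_cons, h, List.map_append, List.prod_append, List.map_cons,
          List.prod_cons, ← mul_assoc (u.map f).prod, hf.prod_mul hau, List.map_append,
          List.prod_append, mul_smul_comm, smul_mul_assoc, mul_smul_comm, ← mul_assoc, ← mul_assoc,
          hf.mul_self, one_mul, smul_smul]
    · exact ⟨a :: l', s, List.nodup_cons.2 ⟨ha, hl'⟩, by
        rw [List.map_cons, List.prod_cons, h, mul_smul_comm, List.map_cons, List.prod_cons]⟩

/-- The star reverses the word, and undoing the reversal takes one transposition for each pair of
letters. -/
theorem star_prod {l : List (Fin d)} (hl : l.Nodup) :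
    star (l.map f).prod = (-1 : ℝ) ^ (l.length.choose 2) • (l.map f).prod := by
  have h : ∀ l : List (Fin d), star (l.map f).prod = (l.reverse.map f).prod := fun l => by
    induction l with
    | nil => simp
    | cons a l ih => simp [star_mul, ih, hf.star_eq]
  rw [h]
  induction l with
  | nil => simp
  | cons a l ih =>
    have hl' := List.nodup_cons.1 hl
    rw [List.reverse_cons, List.map_append, List.prod_append, ih hl'.2]
    simp only [List.map_cons, List.map_nil, List.prod_nil, mul_one, List.prod_cons,
      List.length_cons]
    rw [smul_mul_assoc, hf.prod_mul hl'.1, smul_smul, ← pow_add, Nat.choose_succ_succ' _ 1,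
      Nat.choose_one_right, add_comm]

/-- An even nonempty word changes sign under a cyclic shift by one letter. An odd word missing the
letter `j` changes sign under conjugation by `f j`. The full word matters only for odd `d`, so `d ≡
3 (mod 4)`, where it is skew under the star. -/
theorem trace_prod_eq_zero (hd : d % 4 ≠ 1) (σ : W →ₗ[ℝ] ℝ)
    (hσ : ∀ x y, σ (x * y) = σ (y * x)) (hstar : ∀ x, σ (star x) = σ x) (h1 : σ 1 = 0)
    {l : List (Fin d)} (hl : l.Nodup) : σ (l.map f).prod = 0 := by
  rcases Nat.even_or_odd l.length with heven | hodd
  · cases l with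
    | nil => simpa using h1
    | cons a t =>
      have ht : Odd t.length := by
        rw [List.length_cons] at heven
        exact Nat.not_even_iff_odd.1 (Nat.even_add_one.1 heven)
      have := hσ (f a) (t.map f).prod
      rw [hf.prod_mul (List.nodup_cons.1 hl).1, ht.neg_one_pow, map_smul, smul_eq_mul] at this
      rw [List.map_cons, List.prod_cons]
      linarith
  · by_cases hall : ∀ j, j ∈ l
    · have hlen : l.length = d := by
        rw [← List.toFinset_card_of_nodup hl, (Finset.eq_univ_iff_forall (s := l.toFinset)).2
          fun j => List.mem_toFinset.2 (hall j), Finset.card_univ, Fintype.card_fin]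
      have := hstar (l.map f).prod
      have hc : Odd (l.length.choose 2) := by
        rw [hlen, Nat.choose_two_right]
        rw [hlen] at hodd
        obtain ⟨k, hk⟩ : ∃ k, d = 4 * k + 3 := ⟨d / 4, by
          obtain ⟨r, hr⟩ := hodd
          omega⟩
        rw [hk, show (4 * k + 3) * (4 * k + 3 - 1) = ((4 * k + 3) * (2 * k + 1)) * 2 by
          rw [show 4 * k + 3 - 1 = 4 * k + 2 by omega]; ring, Nat.mul_div_cancel _ two_pos]
        exact Odd.mul ⟨2 * k + 1, by ring⟩ ⟨k, rfl⟩
      rw [hf.star_prod hl, hc.neg_one_pow, map_smul, smul_eq_mul] at this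
      linarith
    · push Not at hall
      obtain ⟨j, hj⟩ := hall
      have e1 := hσ (f j) (f j * (l.map f).prod)
      rw [mul_assoc, hf.prod_mul hj, hodd.neg_one_pow, mul_smul_comm, ← mul_assoc, hf.mul_self,
        one_mul, map_smul, smul_eq_mul] at e1
      linarith

/-- For `d` not congruent to `1` modulo `4`, the only tracial functionals invariant under `star` on
a quotient of the Clifford algebra are the multiples of the normalised trace. -/
theorem trace_eq_zero (hd : d % 4 ≠ 1) (σ : W →ₗ[ℝ] ℝ)
    (hσ : ∀ x y, σ (x * y) = σ (y * x)) (hstar : ∀ x, σ (star x) = σ x) (h1 : σ 1 = 0)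
    {x : W} (hx : x ∈ Algebra.adjoin ℝ (Set.range f)) : σ x = 0 := by
  rw [← Subalgebra.mem_toSubmodule, Algebra.adjoin_eq_span] at hx
  have hle : Submodule.span ℝ (Submonoid.closure (Set.range f) : Set W) ≤ LinearMap.ker σ := by
    rw [Submodule.span_le]
    intro y hy
    obtain ⟨l, rfl⟩ : ∃ l : List (Fin d), (l.map f).prod = y := by
      induction hy using Submonoid.closure_induction with
      | mem y hy => obtain ⟨i, rfl⟩ := hy; exact ⟨[i], by simp⟩
      | one => exact ⟨[], by simp⟩
      | mul y z _ _ hy hz =>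
        obtain ⟨k, rfl⟩ := hy
        obtain ⟨l, rfl⟩ := hz
        exact ⟨k ++ l, by simp⟩
    obtain ⟨l', s, hl', h⟩ := hf.exists_nodup_prod l
    change σ _ = 0
    rw [h, map_smul, hf.trace_prod_eq_zero hd σ hσ hstar h1 hl', smul_zero]
  exact hle hx

end IsCliffordSystem

end Clifford

/-! ### Spin factors and their Clifford bases -/

section SpinFactor

variable {n : ℕ} {ι : Type*} [Fintype ι] {m : ι → ℕ}

/-- In `M_n(ℂ) × ⨁ M_{m i}(ℂ)`, the first projection is injective on the algebra generated by a
Clifford system, except in degrees congruent to `1` modulo `4`. -/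
theorem IsCliffordSystem.eq_zero_of_fst_eq_zero {d : ℕ} {f : Fin d → MatAlg n × SumMatAlg m}
    (hf : IsCliffordSystem f) (hn : n ≠ 0) (hd : d % 4 ≠ 1) {x : MatAlg n × SumMatAlg m}
    (hx : x ∈ Algebra.adjoin ℝ (Set.range f)) (hx1 : x.1 = 0) : x = 0 := by
  let ρ : MatAlg n × SumMatAlg m →ₗ[ℝ] ℝ := reTrace n ∘ₗ LinearMap.fst ℝ _ _
  have hρ : ρ 1 ≠ 0 := by
    simp [ρ, reTrace_apply, hn]
  -- The combination of the total trace and the trace of the first component that kills `1`. It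
  -- vanishes on the whole envelope, so `x* x` with first component `0` has total trace `0`.
  let σ := ρ 1 • prodReTrace n m - prodReTrace n m 1 • ρ
  have hσ : ∀ y, σ y = ρ 1 * prodReTrace n m y - prodReTrace n m 1 * reTrace n y.1 := fun y => rfl
  have hρ1 : ρ 1 = reTrace n 1 := rfl
  have h := hf.trace_eq_zero hd σ
    (fun y z => by
      rw [hσ, hσ, prodReTrace_mul_comm, Prod.fst_mul, Prod.fst_mul, reTrace_mul_comm])
    (fun y => by rw [hσ, hσ, prodReTrace_star, Prod.fst_star, reTrace_star])
    (by rw [hσ, hρ1, Prod.fst_one]; ring)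
    (mul_mem (star_mem_adjoin_of_star_eq (by rintro _ ⟨i, rfl⟩; exact hf.star_eq i) hx) hx)
  rw [hσ, Prod.fst_mul, hx1, mul_zero, map_zero, mul_zero, sub_zero] at h
  exact eq_zero_of_prodReTrace ((mul_eq_zero.1 h).resolve_left hρ)

/-- An orthonormal basis of the vector part of a spin factor. -/
theorem exists_cliffordSystem_span (hn : n ≠ 0) {V : Submodule ℝ (MatAlg n)}
    (hstar : ∀ v ∈ V, star v = v) (hsq : ∀ v ∈ V, ∃ c : ℝ, v * v = c • (1 : MatAlg n)) :
    ∃ e : Fin (Module.finrank ℝ V) → MatAlg n, IsCliffordSystem e ∧ (∀ i, e i ∈ V) ∧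
      Submodule.span ℝ (Set.range e) = V := by
  have hnR : (n : ℝ) ≠ 0 := by exact_mod_cast hn
  -- The normalised trace form satisfies `v² = B(v, v) 1`, so orthogonality for `B` is
  -- anticommutation.
  let B : LinearMap.BilinForm ℝ V :=
    LinearMap.mk₂ ℝ (fun v w : V => (n : ℝ)⁻¹ * reTrace n (v * w))
      (fun a b c => by simp [add_mul, mul_add]) (fun r a b => by simp; ring)
      (fun a b c => by simp [mul_add]) (fun r a b => by simp; ring)
  have hB : ∀ v w : V, B v w = (n : ℝ)⁻¹ * reTrace n (v * w) := fun v w => rfl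
  have hone : reTrace n 1 = n := by simp [reTrace_apply]
  have hBsq : ∀ v : V, (v : MatAlg n) * v = B v v • (1 : MatAlg n) := fun v => by
    obtain ⟨c, hc⟩ := hsq v v.2
    rw [hB, hc, map_smul, hone, smul_eq_mul]
    congr 1
    field_simp
  have hBsymm : ∀ v w, B v w = B w v := fun v w => by rw [hB, hB, reTrace_mul_comm]
  have hBmul : ∀ v w : V, (v : MatAlg n) * w + w * v = (2 * B v w) • (1 : MatAlg n) := fun v w => by
    have h1 := hBsq (v + w)
    simp only [map_add, LinearMap.add_apply, Submodule.coe_add, hBsymm w v, add_mul, mul_add,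
      hBsq v, hBsq w] at h1
    have h2 : (v : MatAlg n) * w + w * v = (B v v + B v w + (B v w + B w w)) • (1 : MatAlg n)
        - B v v • (1 : MatAlg n) - B w w • (1 : MatAlg n) := by
      rw [← h1]; abel
    rw [h2]; module
  have : Invertible (2 : ℝ) := invertibleOfNonzero two_ne_zero
  obtain ⟨b, hb⟩ := LinearMap.BilinForm.exists_orthogonal_basis (B := B) ⟨fun v w => hBsymm v w⟩
  have hpos : ∀ i, 0 < B (b i) (b i) := fun i => by
    have h0 : 0 ≤ reTrace n ((b i : MatAlg n) * b i) := by
      have := reTrace_star_mul_self_nonneg (b i : MatAlg n)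
      rwa [hstar _ (b i).2] at this
    have hne : reTrace n ((b i : MatAlg n) * b i) ≠ 0 := fun h => b.ne_zero i <| by
      ext1
      apply eq_zero_of_reTrace
      rwa [hstar _ (b i).2]
    rw [hB]
    have : (0 : ℝ) < n := by positivity
    have := lt_of_le_of_ne h0 (Ne.symm hne)
    positivity
  set r : Fin (Module.finrank ℝ V) → ℝ := fun i => (Real.sqrt (B (b i) (b i)))⁻¹ with hr
  have hr0 : ∀ i, r i ≠ 0 := fun i => inv_ne_zero (Real.sqrt_pos.2 (hpos i)).ne'
  refine ⟨fun i => r i • (b i : MatAlg n), ⟨fun i => ?_, fun i => ?_, fun i j hij => ?_⟩,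
    fun i => V.smul_mem _ (b i).2, ?_⟩
  · rw [star_smul, hstar _ (b i).2, star_trivial]
  · rw [smul_mul_smul_comm, hBsq, smul_smul, hr]
    simp only
    rw [← mul_inv, Real.mul_self_sqrt (hpos i).le, inv_mul_cancel₀ (hpos i).ne', one_smul]
  · have h := hBmul (b i) (b j)
    have h0 : B (b i) (b j) = 0 := hb hij
    rw [h0, mul_zero, zero_smul] at h
    rw [smul_mul_smul_comm, smul_mul_smul_comm, eq_neg_of_add_eq_zero_left h, smul_neg,
      mul_comm (r i)]
  · refine le_antisymm ?_ fun v hv => ?_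
    · rw [Submodule.span_le]
      rintro _ ⟨i, rfl⟩
      exact V.smul_mem _ (b i).2
    · have h := b.sum_repr ⟨v, hv⟩
      have h' := congrArg (Subtype.val) h
      simp only [Submodule.coe_sum, Submodule.coe_smul] at h'
      rw [← h']
      refine Submodule.sum_mem _ fun i _ => ?_
      have : b.repr ⟨v, hv⟩ i • (b i : MatAlg n) =
          (b.repr ⟨v, hv⟩ i * (r i)⁻¹) • (r i • (b i : MatAlg n)) := by
        rw [smul_smul, mul_assoc, inv_mul_cancel₀ (hr0 i), mul_one]
      rw [this]
      exact Submodule.smul_mem _ _ (Submodule.subset_span ⟨i, rfl⟩)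

end SpinFactor

/-! ### Extension to the real associative envelope -/

section Existence

variable {n : ℕ} {ι : Type*} [Fintype ι] {m : ι → ℕ}

theorem MatAlg.exists_eq_smul_one {a : MatAlg n} (h : ∀ z : MatAlg n, a * z = z * a) :
    ∃ c : ℂ, a = c • (1 : MatAlg n) := by
  have : a ∈ Set.range (Matrix.scalar (Fin n)) :=
    Matrix.mem_range_scalar_of_commute_single fun i j _ => (h (Matrix.single i j 1)).symm
  obtain ⟨c, hc⟩ := this
  exact ⟨c, by rw [← hc, Matrix.smul_one_eq_diagonal]; rfl⟩

theorem MatAlg.exists_eq_real_smul_one (hn : n ≠ 0) {a : MatAlg n} (hs : star a = a)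
    (h : ∀ z : MatAlg n, a * z = z * a) : ∃ c : ℝ, a = c • (1 : MatAlg n) := by
  obtain ⟨c, rfl⟩ := MatAlg.exists_eq_smul_one h
  let i : Fin n := ⟨0, Nat.pos_of_ne_zero hn⟩
  have h1 := congrFun (congrFun hs i) i
  rw [star_smul, star_one] at h1
  simp only [Matrix.smul_apply, Matrix.one_apply_eq, smul_eq_mul, mul_one] at h1
  refine ⟨c.re, ?_⟩
  have : c = (c.re : ℂ) := (Complex.conj_eq_iff_re.1 h1).symm
  conv_lhs => rw [this]
  ext i j
  simp

theorem finrank_of_isSpinFactor_decomposition (hn : n ≠ 0) {A V : Submodule ℝ (MatAlg n)}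
    (hdisj : Disjoint (Submodule.span ℝ {(1 : MatAlg n)}) V)
    (hsup : Submodule.span ℝ {(1 : MatAlg n)} ⊔ V = A) :
    Module.finrank ℝ A = Module.finrank ℝ V + 1 := by
  have : NeZero n := ⟨hn⟩
  have h := Submodule.finrank_sup_add_finrank_inf_eq (Submodule.span ℝ {(1 : MatAlg n)}) V
  rw [hdisj.eq_bot, finrank_bot, add_zero, hsup, finrank_span_singleton one_ne_zero] at h
  omega

/-- The vector part of a spin factor that generates `M_n(ℂ)` does not have dimension one. -/
theorem finrank_ne_one_of_isSpinFactor (hn : n ≠ 0) {A V : Submodule ℝ (MatAlg n)}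
    (hA : IsJordanSubspace A) (hgen : Algebra.adjoin ℂ (A : Set (MatAlg n)) = ⊤)
    (hdisj : Disjoint (Submodule.span ℝ {(1 : MatAlg n)}) V)
    (hsup : Submodule.span ℝ {(1 : MatAlg n)} ⊔ V = A) : Module.finrank ℝ V ≠ 1 := by
  intro h1
  obtain ⟨v, hv0, hv⟩ := finrank_eq_one_iff'.1 h1
  have hvA : (v : MatAlg n) ∈ A := hsup ▸ Submodule.mem_sup_right v.2
  have hcomm : ∀ a ∈ A, (v : MatAlg n) * a = a * v := by
    intro a ha
    rw [← hsup] at ha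
    obtain ⟨x, hx, y, hy, rfl⟩ := Submodule.mem_sup.1 ha
    obtain ⟨c, rfl⟩ := Submodule.mem_span_singleton.1 hx
    obtain ⟨s, hs⟩ := hv ⟨y, hy⟩
    have hs' : s • (v : MatAlg n) = y := congrArg Subtype.val hs
    rw [← hs', mul_add, add_mul, mul_smul_comm, mul_smul_comm, smul_mul_assoc, smul_mul_assoc,
      mul_one, one_mul]
  -- The spanning vector `v` commutes with the generators of `M_n(ℂ)`, so it is a scalar, but the
  -- vector part meets the scalars in `0`.
  have hle : Algebra.adjoin ℂ (A : Set (MatAlg n)) ≤ Subalgebra.centralizer ℂ {(v : MatAlg n)} :=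
    Algebra.adjoin_le fun a ha => by
      rw [SetLike.mem_coe, Subalgebra.mem_centralizer_iff]
      rintro _ rfl
      exact hcomm a ha
  rw [hgen] at hle
  obtain ⟨c, hc⟩ := MatAlg.exists_eq_real_smul_one hn (hA.star_eq _ hvA) fun z =>
    Subalgebra.mem_centralizer_iff ℂ |>.1 (hle (Algebra.mem_top (x := z))) _ rfl
  apply hv0
  ext1
  exact Submodule.disjoint_def.1 hdisj _ (Submodule.mem_span_singleton.2 ⟨c, hc.symm⟩) v.2

/-- The Clifford relations are Jordan relations, so they lift from an orthonormal basis of `V` to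
the graph, whose envelope the lifts generate. -/
theorem eq_zero_of_mem_adjoin_jordanGraph_of_isSpinFactor {A V : Submodule ℝ (MatAlg n)}
    (hn : n ≠ 0) (hA : IsJordanSubspace A) (hsup : Submodule.span ℝ {(1 : MatAlg n)} ⊔ V = A)
    (hsq : ∀ v ∈ V, ∃ c : ℝ, v * v = c • (1 : MatAlg n)) (hd : Module.finrank ℝ V % 4 ≠ 1)
    {g : A →ₗ[ℝ] SumMatAlg m} (hG : IsJordanSubspace (jordanGraph g))
    {x : MatAlg n × SumMatAlg m}
    (hx : x ∈ Algebra.adjoin ℝ (jordanGraph g : Set (MatAlg n × SumMatAlg m))) (hx1 : x.1 = 0) :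
    x = 0 := by
  have hVA : V ≤ A := hsup ▸ le_sup_right
  obtain ⟨e, he, heV, hspan⟩ := exists_cliffordSystem_span hn
    (fun v hv => hA.star_eq v (hVA hv)) hsq
  let f : Fin (Module.finrank ℝ V) → MatAlg n × SumMatAlg m := fun i =>
    (e i, g ⟨e i, hVA (heV i)⟩)
  have hfG : ∀ i, f i ∈ jordanGraph g := fun i => ⟨⟨e i, hVA (heV i)⟩, rfl⟩
  have hf : IsCliffordSystem f :=
    ⟨fun i => hG.star_eq _ (hfG i),
      fun i => jordanGraph_ext (hG.mul_self_mem (hfG i)) hG.one_mem (he.mul_self i),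
      fun i j hij => eq_neg_of_add_eq_zero_left <| jordanGraph_ext
        (hG.mul_add_mul_mem _ (hfG i) _ (hfG j)) (Submodule.zero_mem _)
        (by
          change e i * e j + e j * e i = 0
          rw [he.anticomm i j hij, neg_add_cancel])⟩
  refine hf.eq_zero_of_fst_eq_zero hn hd (Algebra.adjoin_le ?_ hx) hx1
  have hle : A ≤ ((Subalgebra.toSubmodule (Algebra.adjoin ℝ (Set.range f))) ⊓ jordanGraph g).map
      (LinearMap.fst ℝ (MatAlg n) (SumMatAlg m)) := by
    conv_lhs => rw [← hsup, ← hspan]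
    refine sup_le (Submodule.span_le.2 ?_) (Submodule.span_le.2 ?_)
    · rintro _ rfl
      exact ⟨1, ⟨one_mem (Algebra.adjoin ℝ (Set.range f)), hG.one_mem⟩, rfl⟩
    · rintro _ ⟨i, rfl⟩
      exact ⟨f i, ⟨Algebra.subset_adjoin ⟨i, rfl⟩, hfG i⟩, rfl⟩
  rintro _ ⟨a, rfl⟩
  obtain ⟨y, ⟨hy1, hy2⟩, hya⟩ := hle a.2
  have : y = (A.subtype.prod g) a := jordanGraph_ext hy2 ⟨a, rfl⟩ hya
  exact this ▸ hy1

/-- If the envelope of the graph of `g` is a graph, then `g` extends to the envelope. -/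
theorem exists_algHom_of_jordanGraph {R S : Type*} [Ring R] [StarRing R] [Algebra ℝ R]
    [StarModule ℝ R] [Ring S] [StarRing S] [Algebra ℝ S] [StarModule ℝ S] {A : Submodule ℝ R}
    {g : A →ₗ[ℝ] S} (hG : IsJordanSubspace (jordanGraph g))
    (h : ∀ x ∈ Algebra.adjoin ℝ (jordanGraph g : Set (R × S)), x.1 = 0 → x = 0) :
    ∃ Φ : Algebra.adjoin ℝ (A : Set R) →ₐ[ℝ] S,
      (∀ (x : Algebra.adjoin ℝ (A : Set R)) (a : A), (x : R) = a → Φ x = g a) ∧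
      ∀ x y : Algebra.adjoin ℝ (A : Set R), (y : R) = star (x : R) → Φ y = star (Φ x) := by
  set T := Algebra.adjoin ℝ (jordanGraph g : Set (R × S)) with hT
  let φ : T →ₐ[ℝ] R := (AlgHom.fst ℝ R S).comp T.val
  have hφ : Function.Injective φ := (injective_iff_map_eq_zero φ).2 fun x hx =>
    Subtype.ext (h x x.2 hx)
  have hrange : Algebra.adjoin ℝ (A : Set R) ≤ φ.range :=
    Algebra.adjoin_le fun a ha =>
      ⟨⟨(a, g ⟨a, ha⟩), Algebra.subset_adjoin ⟨⟨a, ha⟩, rfl⟩⟩, rfl⟩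
  let ψ := AlgEquiv.ofInjective φ hφ
  let Φ : Algebra.adjoin ℝ (A : Set R) →ₐ[ℝ] S :=
    ((AlgHom.snd ℝ R S).comp T.val).comp
      ((ψ.symm : φ.range →ₐ[ℝ] T).comp (Subalgebra.inclusion hrange))
  have key : ∀ (x : Algebra.adjoin ℝ (A : Set R)) (t : T), (x : R) = (t : R × S).1 →
      Φ x = (t : R × S).2 := fun x t hxt => by
    have : ψ.symm (Subalgebra.inclusion hrange x) = t := by
      rw [AlgEquiv.symm_apply_eq]
      exact Subtype.ext hxt
    change ((ψ.symm (Subalgebra.inclusion hrange x) : T) : R × S).2 = _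
    rw [this]
  refine ⟨Φ, fun x a hxa => key x ⟨(a, g a), Algebra.subset_adjoin ⟨a, rfl⟩⟩ hxa,
    fun x y hxy => ?_⟩
  obtain ⟨t, ht⟩ := hrange x.2
  have ht' : (x : R) = (t : R × S).1 := ht.symm
  rw [key x t ht', key y ⟨star t, star_mem_adjoin_of_star_eq hG.star_eq t.2⟩
    (by rw [hxy, ht']; rfl)]
  rfl

end Existence

/-! ### Passage from a real form to `M_n(ℂ)` -/

section Complexification

variable {n : ℕ}

theorem exists_add_I_smul {A : Submodule ℝ (MatAlg n)}
    (hgen : Algebra.adjoin ℂ (A : Set (MatAlg n)) = ⊤) {R : Subalgebra ℝ (MatAlg n)}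
    (hAR : ∀ a ∈ A, a ∈ R) (z : MatAlg n) : ∃ x ∈ R, ∃ y ∈ R, z = x + Complex.I • y := by
  have hz : z ∈ Algebra.adjoin ℂ (A : Set (MatAlg n)) := hgen ▸ Algebra.mem_top
  induction hz using Algebra.adjoin_induction with
  | mem a ha => exact ⟨a, hAR a ha, 0, zero_mem R, by simp⟩
  | algebraMap c =>
    refine ⟨algebraMap ℝ _ c.re, R.algebraMap_mem _, algebraMap ℝ _ c.im, R.algebraMap_mem _, ?_⟩
    conv_lhs => rw [← Complex.re_add_im c]
    ext i j
    by_cases hij : i = j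
    · subst hij
      simp [Matrix.algebraMap_matrix_apply, mul_comm]
    · simp [Matrix.algebraMap_matrix_apply, hij]
  | add u v _ _ hu hv =>
    obtain ⟨x, hx, y, hy, rfl⟩ := hu
    obtain ⟨x', hx', y', hy', rfl⟩ := hv
    exact ⟨x + x', add_mem hx hx', y + y', add_mem hy hy', by rw [smul_add]; abel⟩
  | mul u v _ _ hu hv =>
    obtain ⟨x, hx, y, hy, rfl⟩ := hu
    obtain ⟨x', hx', y', hy', rfl⟩ := hv
    refine ⟨x * x' - y * y', sub_mem (mul_mem hx hx') (mul_mem hy hy'), x * y' + y * x',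
      add_mem (mul_mem hx hy') (mul_mem hy hx'), ?_⟩
    rw [add_mul, mul_add, mul_add, smul_mul_smul_comm, Complex.I_mul_I, smul_mul_assoc,
      mul_smul_comm, neg_one_smul, smul_add]
    abel

/-- A real subalgebra `R` with `R + i R = M_n(ℂ)` is either everything or meets `i R` trivially. -/
theorem eq_top_or_forall_I_smul {R : Subalgebra ℝ (MatAlg n)}
    (hspan : ∀ z : MatAlg n, ∃ x ∈ R, ∃ y ∈ R, z = x + Complex.I • y) :
    (∀ z, z ∈ R) ∨ ∀ y ∈ R, Complex.I • y ∈ R → y = 0 := by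
  by_contra! hcon
  obtain ⟨⟨w, hw⟩, y, hy, hIy, hy0⟩ := hcon
  have hn : Nonempty (Fin n) := by
    by_contra h
    rw [not_nonempty_iff] at h
    exact hy0 (Subsingleton.elim _ _)
  have hII : ∀ z : MatAlg n, Complex.I • Complex.I • z = -z := fun z => by
    rw [smul_smul, Complex.I_mul_I, neg_one_smul]
  -- The largest complex subspace of `R` is an ideal of `R + iR = M_n(ℂ)`, which is simple.
  let J : TwoSidedIdeal (MatAlg n) := TwoSidedIdeal.mk' {x | x ∈ R ∧ Complex.I • x ∈ R}
    ⟨zero_mem R, by rw [smul_zero]; exact zero_mem R⟩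
    (fun hx hy => ⟨add_mem hx.1 hy.1, by rw [smul_add]; exact add_mem hx.2 hy.2⟩)
    (fun hx => ⟨neg_mem hx.1, by rw [smul_neg]; exact neg_mem hx.2⟩)
    (fun {z x} hx => by
      obtain ⟨u, hu, v, hv, rfl⟩ := hspan z
      constructor
      · rw [add_mul, smul_mul_assoc, ← mul_smul_comm]
        exact add_mem (mul_mem hu hx.1) (mul_mem hv hx.2)
      · rw [add_mul, smul_add, smul_mul_assoc, hII, ← mul_smul_comm]
        exact add_mem (mul_mem hu hx.2) (neg_mem (mul_mem hv hx.1)))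
    (fun {x z} hx => by
      obtain ⟨u, hu, v, hv, rfl⟩ := hspan z
      constructor
      · rw [mul_add, mul_smul_comm, ← smul_mul_assoc]
        exact add_mem (mul_mem hx.1 hu) (mul_mem hx.2 hv)
      · rw [mul_add, smul_add, mul_smul_comm, hII, ← smul_mul_assoc]
        exact add_mem (mul_mem hx.2 hu) (neg_mem (mul_mem hx.1 hv)))
  have hJ : ∀ x, x ∈ J ↔ x ∈ R ∧ Complex.I • x ∈ R := fun x => by
    rw [TwoSidedIdeal.mem_mk']; rfl
  rcases eq_bot_or_eq_top J with h | h
  · have := (hJ y).2 ⟨hy, hIy⟩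
    rw [h, TwoSidedIdeal.mem_bot] at this
    exact hy0 this
  · have := (hJ w).1 (by rw [h]; trivial)
    exact hw this.1

/-- A real `*`-homomorphism on a real form of `M_n(ℂ)` extends to `M_n(ℂ)`. -/
theorem exists_extension_of_add_I_smul {S : Type*} [Ring S] [StarRing S] [Algebra ℝ S]
    [Algebra ℂ S] [IsScalarTower ℝ ℂ S] [StarModule ℂ S] {R : Subalgebra ℝ (MatAlg n)}
    (hspan : ∀ z : MatAlg n, ∃ x ∈ R, ∃ y ∈ R, z = x + Complex.I • y)
    (hstar : ∀ x ∈ R, star x ∈ R) (Φ : R →ₐ[ℝ] S)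
    (hΦ : ∀ x y : R, (y : MatAlg n) = star (x : MatAlg n) → Φ y = star (Φ x)) :
    ∃ Ψ : MatAlg n →ₐ[ℝ] S, (∀ x : R, Ψ x = Φ x) ∧ ∀ z, Ψ (star z) = star (Ψ z) := by
  rcases eq_top_or_forall_I_smul hspan with h | h
  · exact ⟨Φ.comp ((AlgHom.id ℝ (MatAlg n)).codRestrict R h), fun x => rfl,
      fun z => hΦ ⟨z, h z⟩ ⟨star z, h _⟩ rfl⟩
  -- Here the sum `R + iR` is direct, so the complex-linear extension is well defined. In the other
  -- case `Φ` itself serves and need not be complex-linear.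
  · have huniq : ∀ x y x' y' : R, (x : MatAlg n) + Complex.I • (y : MatAlg n) =
        x' + Complex.I • (y' : MatAlg n) → x = x' ∧ y = y' := by
      intro x y x' y' he
      have h1 : Complex.I • ((y : MatAlg n) - y') = x' - x := by
        rw [smul_sub, sub_eq_sub_iff_add_eq_add, add_comm, he, add_comm]
      have h2 := h _ (sub_mem y.2 y'.2) (h1 ▸ sub_mem x'.2 x.2)
      rw [h2, smul_zero] at h1
      exact ⟨Subtype.ext (sub_eq_zero.1 h1.symm).symm, Subtype.ext (sub_eq_zero.1 h2)⟩
    have hspan' : ∀ z : MatAlg n, ∃ x y : R, z = x + Complex.I • (y : MatAlg n) := fun z => by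
      obtain ⟨x, hx, y, hy, hz⟩ := hspan z
      exact ⟨⟨x, hx⟩, ⟨y, hy⟩, hz⟩
    choose re im hreim using hspan'
    have key : ∀ (z : MatAlg n) (x y : R), z = x + Complex.I • (y : MatAlg n) →
        Φ (re z) + Complex.I • Φ (im z) = Φ x + Complex.I • Φ y := fun z x y hz => by
      obtain ⟨h1, h2⟩ := huniq _ _ _ _ ((hreim z).symm.trans hz)
      rw [h1, h2]
    have hone : Φ (re 1) + Complex.I • Φ (im 1) = 1 := by
      rw [key 1 1 0 (by simp)]; simp
    have hcomm : ∀ r : ℝ, Φ (re (algebraMap ℝ _ r)) + Complex.I • Φ (im (algebraMap ℝ _ r)) =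
        algebraMap ℝ S r := fun r => by
      rw [key _ (algebraMap ℝ R r) 0 (by simp)]; simp
    refine ⟨{ toFun := fun z => Φ (re z) + Complex.I • Φ (im z), map_one' := hone,
              map_mul' := fun z w => ?_
              map_zero' := by rw [key 0 0 0 (by simp)]; simp
              map_add' := fun z w => ?_, commutes' := hcomm }, fun x => ?_, fun z => ?_⟩
    · rw [key (z * w) (re z * re w - im z * im w) (re z * im w + im z * re w)]
      · simp only [map_sub, map_add, map_mul]
        rw [add_mul, mul_add, mul_add, smul_mul_smul_comm, Complex.I_mul_I, smul_mul_assoc,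
          mul_smul_comm, neg_one_smul, smul_add]
        abel
      · conv_lhs => rw [hreim z, hreim w]
        rw [add_mul, mul_add, mul_add, smul_mul_smul_comm, Complex.I_mul_I, smul_mul_assoc,
          mul_smul_comm, neg_one_smul]
        push_cast
        rw [smul_add]
        abel
    · rw [key (z + w) (re z + re w) (im z + im w)]
      · simp only [map_add, smul_add]; abel
      · conv_lhs => rw [hreim z, hreim w]
        push_cast
        rw [smul_add]; abel
    · change Φ (re x) + Complex.I • Φ (im x) = _
      rw [key x x 0 (by simp)]; simp
    · change Φ (re (star z)) + Complex.I • Φ (im (star z)) = star (Φ (re z) + Complex.I • Φ (im z))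
      rw [key (star z) ⟨_, hstar _ (re z).2⟩ (-⟨_, hstar _ (im z).2⟩)]
      · rw [map_neg, hΦ (re z) ⟨_, hstar _ (re z).2⟩ rfl, hΦ (im z) ⟨_, hstar _ (im z).2⟩ rfl,
          star_add, star_smul]
        simp
      · conv_lhs => rw [hreim z]
        rw [star_add, star_smul]
        simp

end Complexification

/-! ### Real star homomorphisms between matrix algebras -/

section Form

open Matrix

/-- A projection is `v vᴴ` for an isometry `v`. -/
theorem exists_isometry_of_projection {m : ℕ} {Q : MatAlg m} (hs : star Q = Q) (hQ : Q * Q = Q) :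
    ∃ (p : ℕ) (v : Matrix (Fin m) (Fin p) ℂ), vᴴ * v = 1 ∧ v * vᴴ = Q := by
  have hH : Q.IsHermitian := hs
  set U := (hH.eigenvectorUnitary : MatAlg m) with hU
  have hUU : star U * U = 1 := Unitary.coe_star_mul_self hH.eigenvectorUnitary
  have hUU' : U * star U = 1 := Unitary.coe_mul_star_self hH.eigenvectorUnitary
  have hsp : Q = U * diagonal (RCLike.ofReal ∘ hH.eigenvalues) * star U := by
    conv_lhs => rw [hH.spectral_theorem]
    rfl
  have hD : ∀ i, hH.eigenvalues i * hH.eigenvalues i = hH.eigenvalues i := fun i => by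
    have h1 : diagonal (RCLike.ofReal ∘ hH.eigenvalues : Fin m → ℂ) = star U * Q * U := by
      calc diagonal (RCLike.ofReal ∘ hH.eigenvalues : Fin m → ℂ)
          = (star U * U) * diagonal (RCLike.ofReal ∘ hH.eigenvalues) * (star U * U) := by
            rw [hUU, one_mul, mul_one]
        _ = star U * (U * diagonal (RCLike.ofReal ∘ hH.eigenvalues) * star U) * U := by
            simp only [mul_assoc]
        _ = _ := by rw [← hsp]
    have h2 : diagonal (RCLike.ofReal ∘ hH.eigenvalues : Fin m → ℂ) *
        diagonal (RCLike.ofReal ∘ hH.eigenvalues) = diagonal (RCLike.ofReal ∘ hH.eigenvalues) := by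
      rw [h1]
      calc _ = star U * Q * (U * star U) * Q * U := by simp only [mul_assoc]
        _ = star U * (Q * Q) * U := by rw [hUU', mul_one]; simp only [mul_assoc]
        _ = _ := by rw [hQ]
    rw [diagonal_mul_diagonal] at h2
    have := congrFun (diagonal_injective h2) i
    simp only [Function.comp] at this
    exact_mod_cast this
  let T := {i : Fin m // hH.eigenvalues i = 1}
  let e : T ≃ Fin (Fintype.card T) := Fintype.equivFin T
  refine ⟨Fintype.card T, U.submatrix id fun k => ((e.symm k : T) : Fin m), ?_, ?_⟩
  · have : (U.submatrix id fun k => ((e.symm k : T) : Fin m))ᴴ *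
        (U.submatrix id fun k => ((e.symm k : T) : Fin m)) =
        (star U * U).submatrix (fun k => ((e.symm k : T) : Fin m))
          (fun k => ((e.symm k : T) : Fin m)) := by
      rw [conjTranspose_submatrix, ← Matrix.submatrix_mul _ _ _ _ _ Function.bijective_id]
      rfl
    rw [this, hUU]
    exact submatrix_one _ fun a b h => e.symm.injective (Subtype.ext h)
  · ext i j
    conv_rhs => rw [hsp]
    rw [mul_apply, mul_apply]
    simp only [mul_diagonal, submatrix_apply, conjTranspose_apply, id, star_apply]
    rw [Equiv.sum_comp e.symm fun k : T => U i k * star (U j k)]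
    rw [← Finset.sum_subtype (Finset.univ.filter fun k => hH.eigenvalues k = 1) (by simp)
      (fun k => U i k * star (U j k)), Finset.sum_filter]
    refine Finset.sum_congr rfl fun k _ => ?_
    split_ifs with h
    · simp [h]
    · have : hH.eigenvalues k = 0 := by
        by_contra h0
        exact h (mul_left_cancel₀ h0 ((hD k).trans (mul_one _).symm))
      simp [this]

/-- The diagonal matrix with `p` entries `c` and `q` entries `c̄`. -/
noncomputable def conjDiagonal (p q : ℕ) (c : ℂ) : Matrix (Fin p ⊕ Fin q) (Fin p ⊕ Fin q) ℂ :=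
  diagonal (Sum.elim (fun _ => c) (fun _ => (starRingEnd ℂ) c))

variable {n m : ℕ}

/-- The eigenspaces of `Ψ (i 1)` on the range of `Ψ E`, for a rank one projection `E`. -/
theorem exists_isometry_of_starHom (Ψ : MatAlg n →ₐ[ℝ] MatAlg m)
    (hstar : ∀ z, Ψ (star z) = star (Ψ z)) {E : MatAlg n} (hE : E * E = E) (hEs : star E = E) :
    ∃ (p q : ℕ) (w : Matrix (Fin m) (Fin p ⊕ Fin q) ℂ), wᴴ * w = 1 ∧ w * wᴴ = Ψ E ∧
      ∀ c : ℂ, Ψ (c • (1 : MatAlg n)) * w =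
        w * conjDiagonal p q c := by
  set P := Ψ E with hP
  set K := Ψ (Complex.I • (1 : MatAlg n)) with hK
  have hPP : P * P = P := by rw [hP, ← map_mul, hE]
  have hPs : star P = P := by rw [hP, ← hstar, hEs]
  have hKK : K * K = -1 := by
    rw [hK, ← map_mul, smul_mul_smul_comm, Complex.I_mul_I, mul_one, neg_one_smul, map_neg,
      map_one]
  have hKs : star K = -K := by
    rw [hK, ← hstar, star_smul, star_one, ← map_neg]; simp
  -- `K` is skew with square `-1` and commutes with `P`, so `(P - ε K P)/2` for `ε = ±i` projects
  -- onto the `ε`-eigenspace of `K` inside the range of `P`.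
  have hKP : K * P = P * K := by
    rw [hK, hP, ← map_mul, ← map_mul]; simp
  have hQ : ∀ ε : ℂ, star ε = -ε → ε * ε = -1 →
      star ((1 / 2 : ℂ) • (P + (-ε) • (K * P))) = (1 / 2 : ℂ) • (P + (-ε) • (K * P)) ∧
      ((1 / 2 : ℂ) • (P + (-ε) • (K * P))) * ((1 / 2 : ℂ) • (P + (-ε) • (K * P))) =
        (1 / 2 : ℂ) • (P + (-ε) • (K * P)) ∧
      K * ((1 / 2 : ℂ) • (P + (-ε) • (K * P))) = ε • ((1 / 2 : ℂ) • (P + (-ε) • (K * P))) := by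
    intro ε h1 h2
    have e1 : K * (K * P) = -P := by rw [← mul_assoc, hKK, neg_one_mul]
    have e2 : P * (K * P) = K * P := by rw [← mul_assoc, ← hKP, mul_assoc, hPP]
    have e3 : K * P * P = K * P := by rw [mul_assoc, hPP]
    have e4 : K * P * (K * P) = -P := by rw [mul_assoc, e2, e1]
    refine ⟨?_, ?_, ?_⟩
    · rw [star_smul, star_add, star_smul, star_mul, hPs, hKs, star_neg, h1, mul_neg, ← hKP]
      simp
    · rw [smul_mul_smul_comm, add_mul, mul_add, mul_add, mul_smul_comm, smul_mul_assoc,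
        smul_mul_smul_comm, hPP, e2, e3, e4, neg_mul_neg, h2]
      module
    · have e5 : ε • (P + (-ε) • (K * P)) = ε • P + K * P := by
        rw [smul_add, smul_smul, mul_neg, h2, neg_neg, one_smul]
      rw [mul_smul_comm, mul_add, mul_smul_comm, e1, smul_comm ε (1 / 2 : ℂ), e5]
      module
  obtain ⟨a1, a2, a3⟩ := hQ Complex.I (by simp) Complex.I_mul_I
  obtain ⟨b1, b2, b3⟩ := hQ (-Complex.I) (by simp) (by simp)
  set Q := (1 / 2 : ℂ) • (P + (-Complex.I) • (K * P)) with hQdef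
  set Q' := (1 / 2 : ℂ) • (P + (-(-Complex.I)) • (K * P)) with hQdef'
  obtain ⟨p, v, hv1, hv2⟩ := exists_isometry_of_projection a1 a2
  obtain ⟨q, v', hv1', hv2'⟩ := exists_isometry_of_projection b1 b2
  have hsum : Q + Q' = P := by rw [hQdef, hQdef']; module
  clear_value Q Q'
  have hprod : Q * Q' = 0 := by
    have h : Complex.I • (Q * Q') = -(Complex.I • (Q * Q')) := by
      have hKQ : K * Q = Q * K := by
        have := congrArg star a3
        rw [star_mul, a1, hKs, star_smul, a1, mul_neg] at this
        rw [a3]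
        have h2 : star Complex.I = -Complex.I := by simp
        rw [h2, neg_smul, neg_inj] at this
        exact this.symm
      calc Complex.I • (Q * Q') = K * Q * Q' := by rw [a3, smul_mul_assoc]
        _ = Q * (K * Q') := by rw [hKQ, mul_assoc]
        _ = _ := by rw [b3, mul_smul_comm, neg_smul]
    have h2 : (2 * Complex.I) • (Q * Q') = 0 := by
      rw [two_mul, add_smul]; nth_rewrite 1 [h]; exact neg_add_cancel _
    exact (smul_eq_zero.1 h2).resolve_left (by simp)
  have hvv : vᴴ * v' = 0 := by
    calc vᴴ * v' = (vᴴ * v) * vᴴ * (v' * (v'ᴴ * v')) := by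
          rw [hv1, hv1', Matrix.one_mul, Matrix.mul_one]
      _ = vᴴ * ((v * vᴴ) * (v' * v'ᴴ)) * v' := by simp only [Matrix.mul_assoc]
      _ = 0 := by rw [hv2, hv2', hprod, Matrix.mul_zero, Matrix.zero_mul]
  have hvv' : v'ᴴ * v = 0 := by
    have := congrArg conjTranspose hvv
    rwa [conjTranspose_mul, conjTranspose_conjTranspose, conjTranspose_zero] at this
  have hKv : K * v = Complex.I • v := by
    calc K * v = K * ((v * vᴴ) * v) := by rw [Matrix.mul_assoc v, hv1, Matrix.mul_one]
      _ = Complex.I • ((v * vᴴ) * v) := by rw [hv2, ← Matrix.mul_assoc, a3, Matrix.smul_mul]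
      _ = _ := by rw [Matrix.mul_assoc v, hv1, Matrix.mul_one]
  have hKv' : K * v' = (-Complex.I) • v' := by
    calc K * v' = K * ((v' * v'ᴴ) * v') := by rw [Matrix.mul_assoc v', hv1', Matrix.mul_one]
      _ = (-Complex.I) • ((v' * v'ᴴ) * v') := by
        rw [hv2', ← Matrix.mul_assoc, b3, Matrix.smul_mul]
      _ = _ := by rw [Matrix.mul_assoc v', hv1', Matrix.mul_one]
  have hc : ∀ c : ℂ, Ψ (c • (1 : MatAlg n)) = c.re • (1 : MatAlg m) + c.im • K := fun c => by
    have : c • (1 : MatAlg n) = c.re • 1 + c.im • (Complex.I • (1 : MatAlg n)) := by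
      conv_lhs => rw [← Complex.re_add_im c]
      ext i j
      by_cases hij : i = j
      · subst hij; simp
      · simp [hij]
    rw [this, map_add, map_smul, map_smul, map_one]
  have hcv : ∀ c : ℂ, Ψ (c • (1 : MatAlg n)) * v = c • v := fun c => by
    rw [hc, Matrix.add_mul, Matrix.smul_mul, Matrix.smul_mul, Matrix.one_mul, hKv]
    have : c • v = (c.re : ℂ) • v + (c.im * Complex.I : ℂ) • v := by
      rw [← add_smul, Complex.re_add_im]
    rw [this]
    ext i j
    simp
    ring
  have hcv' : ∀ c : ℂ, Ψ (c • (1 : MatAlg n)) * v' = (starRingEnd ℂ) c • v' := fun c => by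
    rw [hc, Matrix.add_mul, Matrix.smul_mul, Matrix.smul_mul, Matrix.one_mul, hKv']
    have : (starRingEnd ℂ) c • v' = (c.re : ℂ) • v' - (c.im * Complex.I : ℂ) • v' := by
      rw [← sub_smul]
      congr 1
      apply Complex.ext <;> simp
    rw [this]
    ext i j
    simp
    ring
  refine ⟨p, q, fromCols v v', ?_, ?_, fun c => ?_⟩
  · rw [conjTranspose_fromCols_eq_fromRows_conjTranspose, fromRows_mul_fromCols, hv1, hv1', hvv,
      hvv', fromBlocks_one]
  · rw [conjTranspose_fromCols_eq_fromRows_conjTranspose, fromCols_mul_fromRows, hv2, hv2', hsum]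
  · rw [mul_fromCols, hcv, hcv', conjDiagonal]
    ext i s
    rw [mul_diagonal]
    rcases s with s | s <;> simp [mul_comm]

/-- The isometry `w` onto the range of the image of one diagonal matrix unit is carried to the other
diagonal units by the images `F j`; together the blocks `F j w` form a unitary. -/
theorem exists_unitary_of_starHom (hn : n ≠ 0) (Ψ : MatAlg n →ₐ[ℝ] MatAlg m)
    (hstar : ∀ z, Ψ (star z) = star (Ψ z)) :
    ∃ (p q : ℕ) (e : Fin n × (Fin p ⊕ Fin q) ≃ Fin m), n * (p + q) = m ∧
      ∃ U ∈ unitary (MatAlg m), ∀ α, Ψ α = U * Matrix.reindex e e (copies p q α) * star U := by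
  let o : Fin n := ⟨0, Nat.pos_of_ne_zero hn⟩
  obtain ⟨p, q, w, hw1, hw2, hw3⟩ := exists_isometry_of_starHom Ψ hstar
    (E := Matrix.single o o 1) (by simp) (by simp [star_eq_conjTranspose])
  let F : Fin n → MatAlg m := fun j => Ψ (Matrix.single j o 1)
  have hFs : ∀ j, (F j)ᴴ = Ψ (Matrix.single o j 1) := fun j => by
    rw [← star_eq_conjTranspose, ← hstar]; simp [star_eq_conjTranspose]
  let V : Matrix (Fin m) (Fin n × (Fin p ⊕ Fin q)) ℂ := fun a x => (F x.1 * w) a x.2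
  have hVV : Vᴴ * V = 1 := by
    ext ⟨i, s⟩ ⟨j, t⟩
    have h1 : (Vᴴ * V) (i, s) (j, t) = ((F i * w)ᴴ * (F j * w)) s t := rfl
    have h2 : (F i * w)ᴴ * (F j * w) = wᴴ * ((F i)ᴴ * F j) * w := by
      rw [conjTranspose_mul]; simp only [Matrix.mul_assoc]
    rw [h1, h2, hFs, ← map_mul]
    by_cases hij : i = j
    · subst hij
      rw [single_mul_single_same, mul_one, ← hw2, ← Matrix.mul_assoc, hw1, Matrix.one_mul, hw1]
      simp [one_apply]
    · rw [single_mul_single_of_ne _ _ _ _ hij, map_zero]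
      simp [one_apply, hij]
  have hVV' : V * Vᴴ = 1 := by
    have h1 : V * Vᴴ = ∑ j, (F j * w) * (F j * w)ᴴ := by
      ext a b
      rw [mul_apply, Fintype.sum_prod_type, Matrix.sum_apply]
      rfl
    have h2 : ∀ j, (F j * w) * (F j * w)ᴴ = Ψ (Matrix.single j j 1) := fun j => by
      rw [conjTranspose_mul, Matrix.mul_assoc, ← Matrix.mul_assoc w, hw2, hFs, ← map_mul, ← map_mul]
      simp
    rw [h1, Finset.sum_congr rfl fun j _ => h2 j, ← map_sum]
    have : ∑ j, Matrix.single j j (1 : ℂ) = (1 : MatAlg n) := by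
      ext a b
      by_cases hab : a = b
      · subst hab; simp [Matrix.sum_apply, Matrix.single_apply]
      · simp [Matrix.sum_apply, Matrix.single_apply, hab]
    rw [this, map_one]
  have hcard : n * (p + q) = m := by
    have h := Matrix.trace_mul_comm V Vᴴ
    rw [hVV, hVV', Matrix.trace_one, Matrix.trace_one] at h
    have h' : (m : ℂ) = ((n * (p + q) : ℕ) : ℂ) := by simpa using h
    exact_mod_cast h'.symm
  have hmulV : ∀ α, Ψ α * V = V * copies p q α := fun α => by
    -- Expands the single column `α E_{jo}`. The scalars stay inside `Ψ`, which is only real-linear;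
    -- `w` then turns them into `c` or `c̄`.
    have h1 : ∀ j, Ψ α * F j = ∑ l, F l * Ψ (α l j • (1 : MatAlg n)) := fun j => by
      simp only [F, ← map_mul, ← map_sum]
      congr 1
      ext a b
      by_cases hb : b = o
      · subst hb
        simp [Matrix.mul_apply, Matrix.sum_apply, Matrix.single_apply]
      · have hb' : ¬ o = b := fun h => hb h.symm
        simp [Matrix.mul_apply, Matrix.sum_apply, hb']
    ext a ⟨j, s⟩
    have h2 : (Ψ α * V) a (j, s) = (Ψ α * (F j * w)) a s := rfl
    have h3 : Ψ α * (F j * w) = ∑ l, (F l * w) *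
        conjDiagonal p q (α l j) := by
      rw [← Matrix.mul_assoc, h1, Matrix.sum_mul]
      exact Finset.sum_congr rfl fun l _ => by rw [Matrix.mul_assoc, hw3, ← Matrix.mul_assoc]
    rw [h2, h3, Matrix.sum_apply, mul_apply, Fintype.sum_prod_type]
    refine Finset.sum_congr rfl fun l _ => ?_
    rw [conjDiagonal, mul_diagonal, Finset.sum_eq_single s]
    · rcases s with s | s <;> simp [copies, V, blockDiagonal_apply]
    · intro t _ hts
      simp [copies, blockDiagonal_apply, hts]
    · simp
  let e : Fin n × (Fin p ⊕ Fin q) ≃ Fin m := Fintype.equivFinOfCardEq (by simpa using hcard)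
  set U : MatAlg m := V.submatrix id e.symm with hU
  have hUs : star U = Vᴴ.submatrix e.symm id := rfl
  have hUU : U * star U = 1 := by
    rw [hUs, hU, Matrix.submatrix_mul_equiv, hVV', submatrix_id_id]
  refine ⟨p, q, e, hcard, U, ⟨?_, hUU⟩, fun α => ?_⟩
  · rw [hUs, hU, ← Matrix.submatrix_mul _ _ _ _ _ Function.bijective_id, hVV,
      submatrix_one_equiv]
  · have h : Ψ α * U = U * Matrix.reindex e e (copies p q α) := by
      rw [reindex_apply, hU, Matrix.submatrix_mul_equiv, ← hmulV,
        Matrix.submatrix_mul _ _ id id e.symm Function.bijective_id, submatrix_id_id]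
    rw [← h, mul_assoc, hUU, mul_one]

end Form

/-! ### Uniqueness, existence and form of extended encodings -/

section Main

variable {n : ℕ} {ι : Type*} {m : ι → ℕ} {A : Submodule ℝ (MatAlg n)}
  {𝒜 : StarSubalgebra ℝ (MatAlg n)} {B : Submodule ℝ (SumMatAlg m)} {γ : A → B}

theorem ne_zero_of_isSimpleJordan (h : IsSimpleJordan A) : n ≠ 0 := by
  rintro rfl
  exact h.1 (eq_bot_iff.2 fun x _ => (Submodule.mem_bot ℝ).2 (Subsingleton.elim x 0))

/-- Real multiples of `1` lie in `A`, so ring homomorphisms agreeing on `A` agree on the real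
algebra it generates, without assumed linearity. -/
theorem eq_of_extends (hadj : (𝒜 : Set (MatAlg n)) = Algebra.adjoin ℝ (A : Set (MatAlg n)))
    (h1 : (1 : MatAlg n) ∈ A) {Γ Γ' : 𝒜 →+* SumMatAlg m} (hΓ : Extends Γ γ)
    (hΓ' : Extends Γ' γ) : Γ' = Γ := by
  have hmem : ∀ {x : MatAlg n}, x ∈ Algebra.adjoin ℝ (A : Set (MatAlg n)) → x ∈ 𝒜 := fun {x} hx => by
    rw [← SetLike.mem_coe, hadj]; exact hx
  have key : ∀ x (hx : x ∈ Algebra.adjoin ℝ (A : Set (MatAlg n))),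
      Γ' ⟨x, hmem hx⟩ = Γ ⟨x, hmem hx⟩ := by
    intro x hx
    induction hx using Algebra.adjoin_induction with
    | mem a ha => rw [hΓ _ ⟨a, ha⟩ rfl, hΓ' _ ⟨a, ha⟩ rfl]
    | algebraMap r =>
      have hr : algebraMap ℝ (MatAlg n) r ∈ A := by
        rw [Algebra.algebraMap_eq_smul_one]; exact A.smul_mem r h1
      rw [hΓ _ ⟨_, hr⟩ rfl, hΓ' _ ⟨_, hr⟩ rfl]
    | add x y hx hy ihx ihy =>
      have h : (⟨x + y, hmem (add_mem hx hy)⟩ : 𝒜) = ⟨x, hmem hx⟩ + ⟨y, hmem hy⟩ := rfl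
      rw [h, map_add, map_add, ihx, ihy]
    | mul x y hx hy ihx ihy =>
      have h : (⟨x * y, hmem (mul_mem hx hy)⟩ : 𝒜) = ⟨x, hmem hx⟩ * ⟨y, hmem hy⟩ := rfl
      rw [h, map_mul, map_mul, ihx, ihy]
  ext1 x
  have hx : (x : MatAlg n) ∈ Algebra.adjoin ℝ (A : Set (MatAlg n)) := by
    rw [← SetLike.mem_coe, ← hadj]; exact x.2
  exact key x hx

/-- The map `x ↦ Γ(x*)*` also extends `γ`, because `A` and `B` are self-adjoint; uniqueness
identifies it with `Γ`. -/
theorem isExtendedEncoding_of_extends (hA : IsJordanSubspace A) (hB : IsJordanSubspace B)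
    (hadj : (𝒜 : Set (MatAlg n)) = Algebra.adjoin ℝ (A : Set (MatAlg n)))
    {Γ : 𝒜 →+* SumMatAlg m} (hΓ : Extends Γ γ) : IsExtendedEncoding Γ γ := by
  refine ⟨hΓ, fun x => ?_⟩
  let Γ' : 𝒜 →+* SumMatAlg m :=
    { toFun := fun x => star (Γ (star x))
      map_one' := by simp
      map_mul' := fun x y => by simp
      map_zero' := by simp
      map_add' := fun x y => by simp }
  have hΓ' : Extends Γ' γ := fun x a hxa => by
    have hx : star x = x := Subtype.ext (by
      rw [StarMemClass.coe_star, hxa, hA.star_eq a a.2])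
    change star (Γ (star x)) = γ a
    rw [hx, hΓ x a hxa, hB.star_eq _ (γ a).2]
  have h := DFunLike.congr_fun (eq_of_extends hadj hA.one_mem hΓ hΓ') x
  have h' : star (Γ (star x)) = Γ x := h
  rw [← h', star_star]

variable [Fintype ι]

theorem IsEncoding.exists_isExtendedEncoding (hA : IsJordanSubspace A)
    (hsimple : IsSimpleJordan A) (h𝒜 : IsEnveloping A 𝒜) (hB : IsJordanSubspace B)
    (hγ : IsEncoding γ)
    (hspin : ¬ (IsSpinFactor A ∧ ∃ k : ℕ, 1 ≤ k ∧ Module.finrank ℝ A = 4 * k + 2)) :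
    ∃ Γ : 𝒜 →+* SumMatAlg m, IsExtendedEncoding Γ γ := by
  have hn := ne_zero_of_isSimpleJordan hsimple
  obtain ⟨g, hg⟩ := hγ.exists_linearMap hn hB
  have hG : IsJordanSubspace (jordanGraph g) := isJordanSubspace_jordanGraph hA
    ((hg _).trans (hγ.map_one hn hA hB)) (fun a => by rw [hg]; exact hB.star_eq _ (γ a).2)
    (hγ.map_mul_add_mul hA hB g hg)
  have hinj : ∀ x ∈ Algebra.adjoin ℝ (jordanGraph g : Set (MatAlg n × SumMatAlg m)),
      x.1 = 0 → x = 0 := fun x hx hx1 => by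
    by_cases hs : IsSpinFactor A
    · obtain ⟨V, hdisj, hsup, hsq⟩ := id hs
      refine eq_zero_of_mem_adjoin_jordanGraph_of_isSpinFactor hn hA hsup hsq (fun hd => ?_) hG
        hx hx1
      have h1 := finrank_ne_one_of_isSpinFactor hn hA h𝒜.adjoin_eq_top hdisj hsup
      have h2 := finrank_of_isSpinFactor_decomposition hn hdisj hsup
      -- If `dim V = 4k + 1`, then `dim A = 4k + 2`, and `dim V ≠ 1` forces `k ≥ 1`.
      exact hspin ⟨hs, Module.finrank ℝ V / 4, by omega, by omega⟩
    · exact eq_zero_of_mem_adjoin_jordanGraph hn hsimple hs hG hx hx1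
  obtain ⟨Φ, hΦ, hΦs⟩ := exists_algHom_of_jordanGraph hG hinj
  obtain ⟨Ψ, hΨ, hΨs⟩ := exists_extension_of_add_I_smul
    (exists_add_I_smul h𝒜.adjoin_eq_top fun a ha => Algebra.subset_adjoin ha)
    (fun x hx => star_mem_adjoin_of_star_eq hA.star_eq hx) Φ hΦs
  refine ⟨(Ψ : MatAlg n →+* SumMatAlg m).comp (𝒜.toSubalgebra.val : 𝒜 →+* MatAlg n), ?_, ?_⟩
  · intro x a hxa
    change Ψ (x : MatAlg n) = _
    rw [hxa, hΨ ⟨a, Algebra.subset_adjoin a.2⟩, hΦ _ a rfl, hg]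
  · intro x
    exact hΨs x

theorem IsExtendedEncoding.exists_unitary (hA : IsJordanSubspace A)
    (hsimple : IsSimpleJordan A) (h𝒜 : IsEnveloping A 𝒜) (hB : IsJordanSubspace B)
    (hγ : IsEncoding γ) {Γ : 𝒜 →+* SumMatAlg m} (hΓ : IsExtendedEncoding Γ γ) :
    ∃ (p q : ι → ℕ) (e : ∀ i, Fin n × (Fin (p i) ⊕ Fin (q i)) ≃ Fin (m i)),
      (∀ i, n * (p i + q i) = m i) ∧
      ∃ U ∈ unitary (SumMatAlg m), ∀ α : 𝒜,
        Γ α = U * (fun i => Matrix.reindex (e i) (e i) (copies (p i) (q i) (α : MatAlg n)))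
          * star U := by
  have hn := ne_zero_of_isSimpleJordan hsimple
  obtain ⟨g, hg⟩ := hγ.exists_linearMap hn hB
  -- `Γ` is automatically real-linear, since `γ(r 1) = r 1`.
  let Φ : 𝒜.toSubalgebra →ₐ[ℝ] SumMatAlg m :=
    { (Γ : 𝒜 →+* SumMatAlg m) with
      commutes' := fun r => by
        have h := hΓ.extends_map (algebraMap ℝ 𝒜 r) (r • ⟨1, hA.one_mem⟩)
          (Algebra.algebraMap_eq_smul_one r)
        rw [← hg, map_smul, hg, hγ.map_one hn hA hB, ← Algebra.algebraMap_eq_smul_one] at h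
        exact h }
  have hΦ : ∀ x : 𝒜, Φ x = Γ x := fun x => rfl
  obtain ⟨Ψ, hΨ, hΨs⟩ := exists_extension_of_add_I_smul (R := 𝒜.toSubalgebra)
    (exists_add_I_smul h𝒜.adjoin_eq_top h𝒜.mem) (fun x hx => star_mem (s := 𝒜) hx) Φ
    (fun x y hxy => by
      let x' : 𝒜 := ⟨x, x.2⟩
      let y' : 𝒜 := ⟨y, y.2⟩
      have h : y' = star x' := Subtype.ext hxy
      exact (congrArg Γ h).trans (hΓ.map_star x'))
  have hi := fun i => exists_unitary_of_starHom hn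
    ((Pi.evalAlgHom ℝ (fun i => MatAlg (m i)) i).comp Ψ) fun z => congrFun (hΨs z) i
  choose p q e hpq U hU hform using hi
  refine ⟨p, q, e, hpq, U, ⟨funext fun i => (hU i).1, funext fun i => (hU i).2⟩, fun α => ?_⟩
  rw [← hΦ, ← hΨ]
  funext i
  exact hform i α

end Main

theorem mainTheorem1 {n : ℕ} {ι : Type*} [Fintype ι] (m : ι → ℕ)
    (A : Submodule ℝ (MatAlg n)) (hA : IsSpecialJB A) (hsimple : IsSimpleJordan A)
    (𝒜 : StarSubalgebra ℝ (MatAlg n)) (h𝒜 : IsEnveloping A 𝒜)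
    (B : Submodule ℝ (SumMatAlg m)) (hB : IsSpecialJB B)
    (γ : A → B) (hγ : IsEncoding γ) :
    (¬ (IsSpinFactor A ∧ ∃ k : ℕ, 1 ≤ k ∧ Module.finrank ℝ A = 4 * k + 2) →
      ∃ Γ : 𝒜 →+* SumMatAlg m, IsExtendedEncoding Γ γ) ∧
    ((𝒜 : Set (MatAlg n)) = Algebra.adjoin ℝ (A : Set (MatAlg n)) →
      ∀ Γ Γ' : 𝒜 →+* SumMatAlg m, Extends Γ γ → Extends Γ' γ →
        IsExtendedEncoding Γ γ ∧ Γ' = Γ) ∧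
    (∀ Γ : 𝒜 →+* SumMatAlg m, IsExtendedEncoding Γ γ →
      ∃ (p q : ι → ℕ) (e : ∀ i, Fin n × (Fin (p i) ⊕ Fin (q i)) ≃ Fin (m i)),
        (∀ i, n * (p i + q i) = m i) ∧
        ∃ U ∈ unitary (SumMatAlg m), ∀ α : 𝒜,
          Γ α = U * (fun i => Matrix.reindex (e i) (e i) (copies (p i) (q i) (α : MatAlg n)))
            * star U) := by

  have hA' := hA.isJordanSubspace
  have hB' := hB.isJordanSubspace
  exact ⟨hγ.exists_isExtendedEncoding hA' hsimple h𝒜 hB',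
    fun hadj Γ Γ' hΓ hΓ' => ⟨isExtendedEncoding_of_extends hA' hB' hadj hΓ,
      eq_of_extends hadj hA'.one_mem hΓ hΓ'⟩,
    fun Γ hΓ => hΓ.exists_unitary hA' hsimple h𝒜 hB' hγ⟩
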